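/- **Setting.** Let $\tau\ge 2$, $T=\tau+1$, $K\in\mathbb N$. On a probability space, let $X=(X_1,\dots,X_T)$ with $X_t=(X_{1,t},\dots,X_{K,t})'\in\mathbb R^K$, $\gamma\in\mathbb R$ and $\varepsilon=(\varepsilon_1,\dots,\varepsilon_T)\in\mathbb R^T$ be random variables, $\beta_0\in\mathbb R^K\setminus\{0\}$, and $$Y_t=\mathbf 1\{X_t'\beta_0+\gamma-\varepsilon_t\ge 0\},\qquad t=1,\dots,T.$$ Assume that $(X,\gamma)$ and $\varepsilon$ are independent, that the $\varepsilon_t$ are i.i.d. with cumulative distribution function $F$, and that $\mathbb E[X_{k,t}^2]<\infty$ for all $k,t$. Assume that $F$ is generalized logistic: for some $1=\lambda_1<\dots<\lambda_\tau$ and some $w\in(0,\infty)\times[0,\infty)^{\tau-1}$, $$\frac{F(u)}{1-F(u)}=\sum_{j=1}^{\tau}w_j e^{\lambda_j u}\qquad\text{for all }u\in\mathbb R .$$ For $x=(x_1,\dots,x_T)\in(\mathbb R^K)^T$ and $b\in\mathbb R^K$, let $M_t(x;b)$ be $(-1)^{t+1}$ times the determinant of the $(T-1)\times(T-1)$ matrix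 $(e^{\lambda_i x_s'b})_{1\le i\le T-1,\ s\ne t}$, where $s$ runs increasingly over $\{1,\dots,T\}\setminus\{t\}$. Let $$m(y,x;b)=\sum_{t=1}^T\mathbf 1\{y_t=1,\ y_{t'}=0\ \forall t'\ne t\}\,M_t(x;b),\qquad y\in\{0,1\}^T,$$ $$B=\{b\in\mathbb R^K\setminus\{0\}:\ \mathbb E[m(Y,X;b)\mid X]=0\ \text{a.s.}\},\qquad B_k=\{b_k: b\in B\},$$ where $\mathbb E[m(Y,X;b)\mid X]=\sum_{y}\mathbb P(Y=y\mid X)\,m(y,X;b)$. For $j=1,\dots,T-1$, let $D_j(x;b)$ be the determinant of the $T\times T$ matrix with first row $(e^{\lambda_j x_t'\beta_0})_{t=1}^T$ and further rows $(e^{\lambda_i x_t'b})_{t=1}^T$, $i=1,\dots,T-1$. Let $\mathcal D(b)$ be the set of $x\in\mathrm{Supp}(X)$ such that $\max_jD_j(x;b)>\min_jD_j(x;b)\ge0$ or $\min_jD_j(x;b)<\max_jD_j(x;b)\le0$, and let $\widetilde B=\{b\in\mathbb R^K\setminus\{0\}:\mathbb P(X\in\mathcal D(b))=0\}$. **Theorem.**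 1. Suppose that for every $k\in\{1,\dots,K\}$, with positive probability, $X_{k,1},\dots,X_{k,T}$ are $T$ distinct values and $X_{k',t}=0$ for all $k'\neq k$ and all $t$. Then $B$ is finite. If moreover $w_\tau>0$, then for every $k$ $$B_k\subset\{c\,\beta_{0k}:\ c\in\{0\}\cup(1/\lambda_{T-1},\lambda_{T-1})\}.$$ 2. Suppose that the interior of $\mathrm{Supp}(X)\subset\mathbb R^{KT}$ contains a point $(x_1,\dots,x_T)$ with $x_s=x_t$ for some $s<t$. Then $$\widetilde B\subset\{c\beta_0:\ c\in(1/\lambda_{T-1},\lambda_{T-1})\},$$ and, if $w_\tau>0$, also $B\subset\widetilde B$. Moreover $|B|\le T!-1$, and $|B|\le 2$ when $T=3$. For each $k$: if $\beta_{0k}=0$ then $B_k=\{0\}$; if $\beta_{0k}\neq0$ then $0\notin B_k$ and all relative effects $\beta_{0j}/\beta_{0k}$ are point identified, i.e. $\{b_j/b_k: b\in B\}=\{\beta_{0j}/\beta_{0k}\}$ for all $j$. -/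

import Mathlib

open MeasureTheory ProbabilityTheory

namespace PanelBinaryChoice

/-- Trajectories of the regressors: `x t k` is the value of the `k`-th regressor in period `t`. -/
abbrev Regressors (T K : ℕ) : Type := Fin T → Fin K → ℝ

/-- The static binary choice panel model with fixed effects,
`Y_t = 1{X_t'β₀ + γ - ε_t ≥ 0}`, where `(X, γ)` is independent of `(ε_t)_t`, the `ε_t` are i.i.d.
with cdf `F`, the regressors have finite second moments and `β₀ ≠ 0`.
The dependence between `γ` and `X` is unrestricted. -/
structure IsBinaryChoicePanel {Ω : Type*} [MeasurableSpace Ω] (P : Measure Ω) {T K : ℕ}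
    (Y : Ω → Fin T → Fin 2) (X : Ω → Regressors T K) (γ : Ω → ℝ) (ε : Ω → Fin T → ℝ)
    (β₀ : Fin K → ℝ) (F : ℝ → ℝ) : Prop where
  measurable_X : Measurable X
  measurable_γ : Measurable γ
  measurable_ε : Measurable ε
  outcome : ∀ ω t, Y ω t = if 0 ≤ X ω t ⬝ᵥ β₀ + γ ω - ε ω t then 1 else 0
  indep : IndepFun (fun ω => (X ω, γ ω)) ε P
  iIndep : iIndepFun (fun t ω => ε ω t) P
  cdf_eq : ∀ t u, cdf (P.map (fun ω => ε ω t)) u = F u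
  second_moment : ∀ k t, Integrable (fun ω => X ω t k ^ 2) P
  β₀_ne_zero : β₀ ≠ 0

/-- `F` is a generalized logistic distribution function (of the first type) with exponents
`1 = λ₁ < ... < λ_τ` and weights `w ∈ (0, ∞) × [0, ∞)^(τ-1)`:
`F(u) / (1 - F(u)) = ∑ j, w_j exp(λ_j u)`. -/
structure IsGenLogistic {τ : ℕ} (hτ : 2 ≤ τ) (lam w : Fin τ → ℝ) (F : ℝ → ℝ) : Prop where
  lam_first : lam ⟨0, by omega⟩ = 1
  lam_strictMono : StrictMono lam
  w_first : 0 < w ⟨0, by omega⟩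
  w_nonneg : ∀ j, 0 ≤ w j
  odds : ∀ u, F u / (1 - F u) = ∑ j, w j * Real.exp (lam j * u)

/-- `M_t(x; b)`: up to the sign `(-1)^(t+1)` (periods counted from `1`; from `0` this is `(-1)^t`),
the determinant of the matrix `(exp(λ_i x_s'b))`, where `s` ranges over the periods other than `t`,
in increasing order. -/
noncomputable def minorM {τ K : ℕ} (lam : Fin τ → ℝ) (t : Fin (τ + 1)) (x : Regressors (τ + 1) K)
    (b : Fin K → ℝ) : ℝ :=
  (-1) ^ (t : ℕ) *
    (Matrix.of fun i s : Fin τ => Real.exp (lam i * (x (t.succAbove s) ⬝ᵥ b))).det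

/-- The moment function `m(y, x; b) = ∑ t, 1{y_t = 1, y_t' = 0 for t' ≠ t} M_t(x; b)`. -/
noncomputable def momentFun {τ K : ℕ} (lam : Fin τ → ℝ) (y : Fin (τ + 1) → Fin 2)
    (x : Regressors (τ + 1) K) (b : Fin K → ℝ) : ℝ :=
  ∑ t, if y t = 1 ∧ ∀ t', t' ≠ t → y t' = 0 then minorM lam t x b else 0

/-- `E[m(Y, X; b) | X = x]`, computed with the regular conditional distribution of `Y` given `X`.
As `Y` takes finitely many values this is `∑ y, P(Y = y | X = x) m(y, x; b)`; it makes sense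
without any integrability of `m(Y, X; b)` itself. -/
noncomputable def condMoment {Ω : Type*} [MeasurableSpace Ω] (P : Measure Ω) [IsFiniteMeasure P]
    {τ K : ℕ} (Y : Ω → Fin (τ + 1) → Fin 2) (X : Ω → Regressors (τ + 1) K) (lam : Fin τ → ℝ)
    (b : Fin K → ℝ) (x : Regressors (τ + 1) K) : ℝ :=
  ∫ y, momentFun lam y x b ∂(condDistrib Y X P x)

/-- The identified set `B = {b ≠ 0 : E[m(Y, X; b) | X] = 0 a.s.}`. -/
def identifiedSet {Ω : Type*} [MeasurableSpace Ω] (P : Measure Ω) [IsFiniteMeasure P]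
    {τ K : ℕ} (Y : Ω → Fin (τ + 1) → Fin 2) (X : Ω → Regressors (τ + 1) K) (lam : Fin τ → ℝ) :
    Set (Fin K → ℝ) :=
  {b | b ≠ 0 ∧ ∀ᵐ ω ∂P, condMoment P Y X lam b (X ω) = 0}

/-- `B_k`, the projection of a set `B` of parameters on the `k`-th coordinate. -/
def coordSet {K : ℕ} (B : Set (Fin K → ℝ)) (k : Fin K) : Set ℝ :=
  (fun b => b k) '' B

/-- `D_j(x; b)`: the determinant of the matrix with first row `(exp(λ_j x_t'β₀))_t`, followed by
the rows `(exp(λ_i x_t'b))_t`, `i = 1, ..., τ`. -/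
noncomputable def detD {τ K : ℕ} (lam : Fin τ → ℝ) (β₀ : Fin K → ℝ) (j : Fin τ)
    (x : Regressors (τ + 1) K) (b : Fin K → ℝ) : ℝ :=
  (Matrix.of (Fin.cons (fun t => Real.exp (lam j * (x t ⬝ᵥ β₀)))
    (fun i t => Real.exp (lam i * (x t ⬝ᵥ b)))) : Matrix (Fin (τ + 1)) (Fin (τ + 1)) ℝ).det

/-- The support of the random variable `X`. -/
noncomputable def supp {Ω : Type*} [MeasurableSpace Ω] (P : Measure Ω) {T K : ℕ}
    (X : Ω → Regressors T K) : Set (Regressors T K) :=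
  (P.map X).support

/-- The set `𝒟(b)` of the `x` in the support of `X` such that
`max_j D_j(x; b) > min_j D_j(x; b) ≥ 0` or `min_j D_j(x; b) < max_j D_j(x; b) ≤ 0`. -/
def signSet {Ω : Type*} [MeasurableSpace Ω] (P : Measure Ω) {τ K : ℕ}
    (X : Ω → Regressors (τ + 1) K) (lam : Fin τ → ℝ) (β₀ b : Fin K → ℝ) :
    Set (Regressors (τ + 1) K) :=
  {x | x ∈ supp P X ∧
    (((⨅ j, detD lam β₀ j x b) < (⨆ j, detD lam β₀ j x b) ∧ 0 ≤ ⨅ j, detD lam β₀ j x b) ∨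
     ((⨅ j, detD lam β₀ j x b) < (⨆ j, detD lam β₀ j x b) ∧ (⨆ j, detD lam β₀ j x b) ≤ 0))}

/-- The outer set `B̃ = {b ≠ 0 : P(X ∈ 𝒟(b)) = 0}`. -/
def outerSet {Ω : Type*} [MeasurableSpace Ω] (P : Measure Ω) {τ K : ℕ}
    (X : Ω → Regressors (τ + 1) K) (lam : Fin τ → ℝ) (β₀ : Fin K → ℝ) : Set (Fin K → ℝ) :=
  {b | b ≠ 0 ∧ P {ω | X ω ∈ signSet P X lam β₀ b} = 0}

/-- Discrete regressors: for each `k`, with positive probability, the `k`-th regressor takes `T`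
distinct values over the `T` periods while all the other regressors vanish in every period. -/
def DiscreteRegressors {Ω : Type*} [MeasurableSpace Ω] (P : Measure Ω) {T K : ℕ}
    (X : Ω → Regressors T K) : Prop :=
  ∀ k : Fin K, 0 < P {ω | (Set.range fun t => X ω t k).ncard = T ∧
    ∀ k', k' ≠ k → ∀ t, X ω t k' = 0}

/-- Continuous regressors with overlapping supports in two periods: the support of `X` has an
interior point whose components in two different periods `s < t` coincide. -/
def ContinuousRegressors {Ω : Type*} [MeasurableSpace Ω] (P : Measure Ω) {T K : ℕ}
    (X : Ω → Regressors T K) : Prop :=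
  ∃ (s t : Fin T) (x : Fin K → ℝ), s < t ∧ ∃ z ∈ interior (supp P X), z s = x ∧ z t = x

end PanelBinaryChoice

namespace PanelBinaryChoice

/-! Given the regressors and the fixed effect, the probability that only period `t` is positive
equals the odds at `t` times a product not depending on `t`. The odds are a sum of exponentials, so
integrating out the fixed effect gives probabilities `∑ j, a j * exp (λ_j x_t'β₀)` with `a j ≥ 0`,
and `a j > 0` when `w j > 0`. The moment is a determinant with these probabilities as first row,
hence equals `∑ j, a j * D_j(x; b)` (`exists_condMoment_eq`). At `b = β₀` every `D_j` has a repeated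
row, so `β₀` lies in `B`. A parameter `b` is excluded once, with positive probability, the `D_j`
share a weak sign and some `D_j` with positive weight is nonzero.

The signs come from generalized Vandermonde determinants, which do not vanish because exponential
sums have few zeros (Rolle). If `b = c β₀` with `c ≠ 0` and the indices `x_t'β₀` are distinct, `D_j`
is the value at `μ = λ_j` of a continuous function of `μ` that vanishes only at the points `c λ_i`.
For `c` outside `(1/λ_τ, λ_τ)` all these points lie weakly on one side of all the `λ_j`, so the
`D_j` share a sign (`expDet_exp_same_sign`). If `b` is not proportional to `β₀`, one perturbs a
trajectory with `x_s = x_t` so that `x_s'b = x_t'b` but `x_s'β₀ ≠ x_t'β₀`; then `D_j` is a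
difference of two exponentials times a common cofactor (`exists_detD_same_strict_sign`).

For the cardinality, `c ↦ ∑ j, a j * D_j(x; c β₀)` is an exponential sum with `T!` terms that is
nonzero at `c = λ_τ + 1`; for `T = 3` it has three sign changes, and `c = 0` uses up one zero. With
discrete regressors only the `k`-th coordinate matters on the relevant event, and the same arguments
apply to `b_k`. -/

/-! ### Zeros of exponential sums -/

/-- Rolle: a differentiable function has at most one zero more than its derivative. -/
lemma encard_zeros_le_deriv {f f' : ℝ → ℝ} (hf : ∀ x, HasDerivAt f (f' x) x) :
    {x | f x = 0}.encard ≤ {x | f' x = 0}.encard + 1 := by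
  by_contra! hlt
  have hfin : {x | f' x = 0}.Finite := by
    by_contra hinf
    rw [Set.Infinite.encard_eq hinf] at hlt
    simp at hlt
  -- A finite set of zeros with exactly two more elements than there are zeros of `f'`; Rolle
  -- interleaves a zero of `f'` between any two of them, which is too many.
  obtain ⟨s, hs, hcard⟩ := Set.exists_subset_encard_eq (Order.add_one_le_of_lt hlt)
  rw [hfin.encard_eq_coe_toFinset_card] at hcard
  have hsf : s.Finite := Set.finite_of_encard_eq_coe (k := hfin.toFinset.card + 1 + 1) (by
    rw [hcard]; push_cast; rfl)
  rw [hsf.encard_eq_coe_toFinset_card] at hcard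
  have := Finset.card_le_of_interleaved (s := hsf.toFinset) (t := hfin.toFinset)
    (fun x hx y hy hxy _ => by
      have hx0 : f x = 0 := hs (by simpa using hx)
      have hy0 : f y = 0 := hs (by simpa using hy)
      obtain ⟨z, hz, hz'⟩ := exists_hasDerivAt_eq_zero hxy
        (fun z _ => (hf z).continuousAt.continuousWithinAt) (hx0.trans hy0.symm)
        (fun z _ => hf z)
      exact ⟨z, by simpa using hz', hz.1, hz.2⟩)
  have h2 : hsf.toFinset.card = hfin.toFinset.card + 1 + 1 := by exact_mod_cast hcard
  omega

/-- The exponential sum with exponents `κ` and coefficients `r`. -/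
noncomputable def expSum {ι : Type*} [Fintype ι] (κ r : ι → ℝ) (c : ℝ) : ℝ :=
  ∑ k, r k * Real.exp (κ k * c)

/-- Descartes' rule of signs for exponential sums: if the coefficients have the signs of
`∏ θ ∈ L, (κ - θ)`, there are at most `L.length` zeros. -/
lemma encard_zeros_expSum_le_length {ι : Type*} [Fintype ι] (κ : ι → ℝ) (L : List ℝ) :
    ∀ r : ι → ℝ, (∀ k, 0 ≤ r k * (L.map (κ k - ·)).prod) →
      (∃ k, 0 < r k * (L.map (κ k - ·)).prod) →
      {c | expSum κ r c = 0}.encard ≤ L.length := by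
  induction L with
  | nil =>
    intro r hr ⟨k, hk⟩
    have : {c | expSum κ r c = 0} = ∅ := by
      ext c
      simp only [Set.mem_ofPred_eq, Set.mem_empty_iff_false, iff_false]
      refine (Finset.sum_pos' (fun i _ => ?_) ⟨k, Finset.mem_univ _, ?_⟩).ne'
      · exact mul_nonneg (by simpa using hr i) (Real.exp_pos _).le
      · exact mul_pos (by simpa using hk) (Real.exp_pos _)
    simp [this]
  | cons θ L ih =>
    intro r hr ⟨k, hk⟩
    have key := ih (fun k => r k * (κ k - θ)) (fun k => by simpa [mul_assoc] using hr k)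
      ⟨k, by simpa [mul_assoc] using hk⟩
    -- Multiplying by `exp (-θ c)` keeps the zeros, and differentiating then multiplies each
    -- coefficient by `κ k - θ`: one root of the sign polynomial is removed at the price of one
    -- zero.
    have hd : ∀ c, HasDerivAt (fun c => Real.exp (-θ * c) * expSum κ r c)
        (Real.exp (-θ * c) * expSum κ (fun k => r k * (κ k - θ)) c) c := by
      intro c
      have h1 : HasDerivAt (fun c => Real.exp (-θ * c)) (Real.exp (-θ * c) * (-θ)) c := by
        simpa using ((hasDerivAt_id c).const_mul (-θ)).exp
      have h2 : HasDerivAt (expSum κ r) (∑ k, r k * (Real.exp (κ k * c) * κ k)) c := by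
        unfold expSum
        refine HasDerivAt.fun_sum fun i _ => HasDerivAt.const_mul _ ?_
        simpa using ((hasDerivAt_id c).const_mul (κ i)).exp
      refine (h1.mul h2).congr_deriv ?_
      simp only [expSum, Finset.mul_sum]
      rw [add_comm, ← Finset.sum_add_distrib]
      exact Finset.sum_congr rfl fun i _ => by ring
    have := encard_zeros_le_deriv hd
    simp only [mul_eq_zero, (Real.exp_pos _).ne', false_or] at this
    refine this.trans ?_
    push_cast [List.length_cons]
    gcongr

/-- A nontrivial exponential sum with `n` distinct exponents has at most `n - 1` zeros. -/
lemma encard_zeros_expSum_lt {ι : Type*} [Fintype ι] {κ : ι → ℝ} (hκ : Function.Injective κ)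
    {r : ι → ℝ} (hr : r ≠ 0) :
    {c | expSum κ r c = 0}.encard + 1 ≤ Fintype.card ι := by
  classical
  obtain ⟨k₀, hk₀⟩ := Function.ne_iff.mp hr
  simp only [Pi.zero_apply] at hk₀
  -- With all exponents but `κ k₀` as roots, the sign condition is trivial except at `k₀`, where it
  -- holds for `r` or for `-r`.
  set L : List ℝ := ((Finset.univ.erase k₀).toList.map κ) with hL
  have hlen : L.length + 1 = Fintype.card ι := by
    simp only [hL, List.length_map, Finset.length_toList]
    exact Finset.card_erase_add_one (Finset.mem_univ k₀)
  have hzero : ∀ k, k ≠ k₀ → (L.map (κ k - ·)).prod = 0 := by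
    intro k hk
    rw [List.prod_eq_zero_iff]
    simp only [hL, List.map_map, List.mem_map, Finset.mem_toList, Finset.mem_erase]
    exact ⟨k, ⟨hk, Finset.mem_univ _⟩, by simp⟩
  have hne : (L.map (κ k₀ - ·)).prod ≠ 0 := by
    rw [Ne, List.prod_eq_zero_iff]
    simp only [hL, List.map_map, List.mem_map, Finset.mem_toList, Finset.mem_erase]
    rintro ⟨k, ⟨hk, _⟩, h⟩
    exact hk (hκ (sub_eq_zero.mp h)).symm
  have main : ∀ r : ι → ℝ, 0 < r k₀ * (L.map (κ k₀ - ·)).prod →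
      {c | expSum κ r c = 0}.encard ≤ L.length := fun r h =>
    encard_zeros_expSum_le_length κ L r (fun k => by
      by_cases hk : k = k₀
      · exact hk ▸ h.le
      · simp [hzero k hk]) ⟨k₀, h⟩
  rw [← hlen]
  push_cast
  gcongr
  rcases (mul_ne_zero hk₀ hne).lt_or_gt with h | h
  · have := main (-r) (by simpa using h)
    simpa [expSum] using this
  · exact main r h

/-- An exponential sum with `n` terms that does not vanish identically has at most `n - 1`
zeros. -/
lemma encard_zeros_expSum_lt_of_ne_zero {ι : Type*} [Fintype ι] {κ r : ι → ℝ} {c₀ : ℝ}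
    (h : expSum κ r c₀ ≠ 0) : {c | expSum κ r c = 0}.encard + 1 ≤ Fintype.card ι := by
  classical
  -- Terms with equal exponents are merged, which can only lower the number of terms.
  set S := Finset.univ.image κ
  set r' : S → ℝ := fun x => ∑ k with κ k = x, r k
  have heq : ∀ c, expSum (fun x : S => (x : ℝ)) r' c = expSum κ r c := by
    intro c
    simp only [expSum, r']
    rw [Finset.sum_coe_sort S (fun x => (∑ k with κ k = x, r k) * Real.exp (x * c)),
      ← Finset.sum_fiberwise_of_maps_to (s := Finset.univ) (t := S) (g := κ)
        (fun k _ => Finset.mem_image_of_mem κ (Finset.mem_univ k))]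
    refine Finset.sum_congr rfl fun x _ => ?_
    rw [Finset.sum_mul]
    refine Finset.sum_congr rfl fun k hk => ?_
    rw [(Finset.mem_filter.mp hk).2]
  have hr' : r' ≠ 0 := by
    intro h0
    apply h
    rw [← heq, h0]
    simp [expSum]
  have := encard_zeros_expSum_lt Subtype.val_injective hr'
  simp only [heq] at this
  refine this.trans ?_
  rw [Fintype.card_coe]
  exact_mod_cast Finset.card_image_le

/-! ### Generalized Vandermonde determinants -/

/-- A vanishing combination of the rows would be a nontrivial exponential sum with `n` distinct
exponents and the `n` zeros `u t`, one too many. -/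
lemma det_exp_ne_zero {n : ℕ} {μ u : Fin n → ℝ} (hμ : Function.Injective μ)
    (hu : Function.Injective u) :
    (Matrix.of fun i t : Fin n => Real.exp (μ i * u t)).det ≠ 0 := by
  intro h
  obtain ⟨r, hr, h0⟩ := Matrix.exists_vecMul_eq_zero_iff.mpr h
  have hz : Set.range u ⊆ {c | expSum μ r c = 0} := by
    rintro _ ⟨t, rfl⟩
    have := congrFun h0 t
    simpa [Matrix.vecMul, dotProduct, expSum] using this
  have h1 := encard_zeros_expSum_lt hμ hr
  have h2 := Set.encard_le_encard hz
  rw [← Set.image_univ, hu.encard_image, Set.encard_univ] at h2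
  simp only [ENat.card_eq_coe_fintype_card] at h2
  have h3 := (add_le_add_left h2 1).trans h1
  have h4 : Fintype.card (Fin n) + 1 ≤ Fintype.card (Fin n) := by exact_mod_cast h3
  omega

/-- The determinant of the matrix with first row `g` and rows `(exp(λ_i v_t))_t` below. -/
noncomputable def expDet {τ : ℕ} (lam : Fin τ → ℝ) (v g : Fin (τ + 1) → ℝ) : ℝ :=
  (Matrix.of (Fin.cons g (fun i t => Real.exp (lam i * v t))) :
    Matrix (Fin (τ + 1)) (Fin (τ + 1)) ℝ).det

/-- The cofactor of the `t`-th entry of the first row in `expDet`. -/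
noncomputable def expCofactor {τ : ℕ} (lam : Fin τ → ℝ) (v : Fin (τ + 1) → ℝ)
    (t : Fin (τ + 1)) : ℝ :=
  (-1) ^ (t : ℕ) * (Matrix.of fun i s : Fin τ => Real.exp (lam i * v (t.succAbove s))).det

section
variable {τ : ℕ} (lam : Fin τ → ℝ) (v : Fin (τ + 1) → ℝ)

lemma expDet_eq_sum (g : Fin (τ + 1) → ℝ) :
    expDet lam v g = ∑ t, g t * expCofactor lam v t := by
  rw [expDet, Matrix.det_succ_row_zero]
  refine Finset.sum_congr rfl fun t _ => ?_
  have : (Matrix.of (Fin.cons g fun i t => Real.exp (lam i * v t)) :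
      Matrix (Fin (τ + 1)) (Fin (τ + 1)) ℝ).submatrix Fin.succ t.succAbove =
      Matrix.of fun i s : Fin τ => Real.exp (lam i * v (t.succAbove s)) := by
    ext i s; simp
  rw [this, expCofactor]
  simp
  ring

lemma expDet_sum {ι : Type*} (s : Finset ι) (a : ι → ℝ) (g : ι → Fin (τ + 1) → ℝ) :
    expDet lam v (fun t => ∑ j ∈ s, a j * g j t) = ∑ j ∈ s, a j * expDet lam v (g j) := by
  simp only [expDet_eq_sum, Finset.mul_sum, Finset.sum_mul]
  rw [Finset.sum_comm]
  simp only [mul_assoc]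

/-- `expDet` vanishes when its first row is one of the further rows. -/
lemma expDet_row_eq_zero (j : Fin τ) : expDet lam v (fun t => Real.exp (lam j * v t)) = 0 :=
  Matrix.det_zero_of_row_eq (i := 0) (j := j.succ) (Fin.succ_ne_zero j).symm (by ext t; simp)

lemma expDet_eq_zero_of_col_eq {g : Fin (τ + 1) → ℝ} {s t : Fin (τ + 1)} (hst : s ≠ t)
    (hg : g s = g t) (hv : v s = v t) : expDet lam v g = 0 :=
  Matrix.det_zero_of_column_eq hst (fun i => by
    refine Fin.cases ?_ (fun i => ?_) i <;> simp [hg, hv])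

/-- With `v = c • u`, all rows are exponentials in the same nodes `u`, with exponents `μ` and `c *
lam i`, which are distinct. -/
lemma expDet_exp_ne_zero {lam} {v} {μ : ℝ} {u : Fin (τ + 1) → ℝ} (hu : Function.Injective u) {c : ℝ}
    (hv : v = c • u) (hc : c ≠ 0) (hlam : Function.Injective lam) (hμ : ∀ i, μ ≠ c * lam i) :
    expDet lam v (fun t => Real.exp (μ * u t)) ≠ 0 := by
  have hinj : Function.Injective (Fin.cons μ (fun i => c * lam i) : Fin (τ + 1) → ℝ) := by
    rw [Fin.cons_injective_iff]
    refine ⟨?_, fun i j h => hlam (mul_left_cancel₀ hc h)⟩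
    rintro ⟨i, hi⟩
    exact hμ i hi.symm
  convert det_exp_ne_zero hinj hu using 1
  unfold expDet
  congr 1
  ext i t
  refine Fin.cases ?_ (fun i => ?_) i
  · simp
  · simp only [Matrix.of_apply, Fin.cons_succ, hv, Pi.smul_apply, smul_eq_mul]
    congr 1; ring

/-- Shifting all the `v_t` and `g` multiplies `expDet` by a positive factor. -/
lemma expDet_shift (g : Fin (τ + 1) → ℝ) (a d : ℝ) :
    expDet lam (fun t => v t + d) (fun t => a * g t) =
      a * Real.exp ((∑ i, lam i) * d) * expDet lam v g := by
  have : Real.exp ((∑ i, lam i) * d) = ∏ i, Real.exp (lam i * d) := by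
    rw [← Real.exp_sum, Finset.sum_mul]
  have h2 : a * Real.exp ((∑ i, lam i) * d) =
      ∏ i, (Fin.cons a (fun i => Real.exp (lam i * d)) : Fin (τ + 1) → ℝ) i := by
    rw [Fin.prod_univ_succ, this]; simp
  rw [h2, expDet, expDet, ← Matrix.det_mul_column]
  congr 1
  ext i t
  refine Fin.cases ?_ (fun i => ?_) i
  · simp
  · simp [mul_add, Real.exp_add, mul_comm]

lemma expCofactor_ne_zero {lam} {v} (hlam : Function.Injective lam) {t : Fin (τ + 1)}
    (hv : ∀ r r', r ≠ t → r' ≠ t → v r = v r' → r = r') : expCofactor lam v t ≠ 0 := by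
  refine mul_ne_zero (pow_ne_zero _ (by norm_num)) (det_exp_ne_zero hlam ?_)
  intro i j hij
  exact Fin.succAbove_right_injective
    (hv _ _ (Fin.succAbove_ne _ _) (Fin.succAbove_ne _ _) hij)

lemma expCofactor_eq_zero {s t r : Fin (τ + 1)} (hst : s ≠ t) (hsr : s ≠ r) (htr : t ≠ r)
    (hv : v s = v t) : expCofactor lam v r = 0 := by
  have := expDet_eq_zero_of_col_eq lam v (g := Pi.single r 1) hst (by simp [hsr, htr]) hv
  rw [expDet_eq_sum] at this
  simpa [Pi.single_apply] using this

/-- If `v_s = v_t`, then `expDet` reduces to a single cofactor. -/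
lemma expDet_of_col_eq [NeZero τ] {s t : Fin (τ + 1)} (hst : s ≠ t) (hv : v s = v t)
    (g : Fin (τ + 1) → ℝ) : expDet lam v g = (g t - g s) * expCofactor lam v t := by
  have key : ∀ g : Fin (τ + 1) → ℝ,
      expDet lam v g = g s * expCofactor lam v s + g t * expCofactor lam v t := by
    intro g
    rw [expDet_eq_sum, ← Finset.sum_pair (f := fun r => g r * expCofactor lam v r) hst]
    refine (Finset.sum_subset (Finset.subset_univ _) fun r _ hr => ?_).symm
    simp only [Finset.mem_insert, Finset.mem_singleton, not_or] at hr
    rw [expCofactor_eq_zero lam v hst (Ne.symm hr.1) (Ne.symm hr.2) hv, mul_zero]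
  -- Testing with a repeated row, whose entries at `s` and `t` are equal and positive, shows that
  -- the two remaining cofactors are opposite.
  have h0 := key _ ▸ expDet_row_eq_zero lam v 0
  rw [hv, ← mul_add] at h0
  have h1 := (mul_eq_zero.mp h0).resolve_left (Real.exp_pos _).ne'
  rw [key, eq_neg_of_add_eq_zero_left h1]
  ring

end

/-! ### Signs of the determinants when `b` is proportional to `β₀` -/

lemma sign_const_on_closure {E : ℝ → ℝ} (hE : Continuous E) {s : Set ℝ} (hs : IsPreconnected s)
    (h0 : ∀ x ∈ s, E x ≠ 0) :
    (∀ x ∈ closure s, 0 ≤ E x) ∨ (∀ x ∈ closure s, E x ≤ 0) := by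
  have : (∀ x ∈ s, 0 ≤ E x) ∨ (∀ x ∈ s, E x ≤ 0) := by
    by_contra! hcon
    obtain ⟨⟨x, hx, hx'⟩, y, hy, hy'⟩ := hcon
    obtain ⟨z, hz, hz'⟩ := hs.intermediate_value hx hy hE.continuousOn ⟨hx'.le, hy'.le⟩
    exact h0 z hz hz'
  refine this.imp (fun h x hx => ?_) (fun h x hx => ?_)
  · exact closure_minimal (t := {x | 0 ≤ E x}) h (isClosed_le continuous_const hE) hx
  · exact closure_minimal (t := {x | E x ≤ 0}) h (isClosed_le hE continuous_const) hx

section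
variable {τ : ℕ} {lam : Fin τ → ℝ} {u v : Fin (τ + 1) → ℝ} {c : ℝ}

lemma continuous_expDet_exp : Continuous fun μ => expDet lam v fun t => Real.exp (μ * u t) := by
  simp only [expDet_eq_sum]
  fun_prop

/-- The first rows `exp(μ u_t)` with exponents `μ` beyond all the exponents `c λ_i` of the further
rows give determinants of the same weak sign. -/
lemma expDet_exp_same_sign (hlam : StrictMono lam) {f l : Fin τ} (hf : ∀ i, f ≤ i)
    (hl : ∀ i, i ≤ l) (hone : lam f = 1) (hc : c ≠ 0)
    (hc' : c ∉ Set.Ioo (1 / lam l) (lam l)) (hv : v = c • u) :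
    (∀ j, 0 ≤ expDet lam v fun t => Real.exp (lam j * u t)) ∨
      (∀ j, (expDet lam v fun t => Real.exp (lam j * u t)) ≤ 0) := by
  by_cases hu : Function.Injective u
  swap
  · simp only [Function.Injective, not_forall] at hu
    obtain ⟨s, t, hst, hne⟩ := hu
    refine Or.inl fun j => (expDet_eq_zero_of_col_eq lam v hne ?_ ?_).ge
    · simp only [hst]
    · simp [hv, hst]
  have h1 : ∀ i, 1 ≤ lam i := fun i => hone ▸ hlam.monotone (hf i)
  have h2 : ∀ i, lam i ≤ lam l := fun i => hlam.monotone (hl i)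
  have hl0 : 0 < lam l := zero_lt_one.trans_le (h1 l)
  -- An interval free of the zeros `c * lam i` whose closure contains every `lam j`. The closure is
  -- needed because at `c = 1 / lam l` or `c = lam l` an endpoint zero meets some `lam j`. The cases
  -- are `c < 0`, `0 < c ≤ 1 / lam l` and `lam l ≤ c`.
  obtain ⟨s, hs, hsj, hsi⟩ : ∃ s : Set ℝ, IsPreconnected s ∧ (∀ j, lam j ∈ closure s) ∧
      ∀ μ ∈ s, ∀ i, μ ≠ c * lam i := by
    rcases hc.lt_or_gt with hneg | hpos
    · refine ⟨Set.Ioi 0, isPreconnected_Ioi, fun j => subset_closure ?_, fun μ hμ i h => ?_⟩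
      · exact zero_lt_one.trans_le (h1 j)
      · have : c * lam i < 0 := mul_neg_of_neg_of_pos hneg (zero_lt_one.trans_le (h1 i))
        rw [Set.mem_Ioi, h] at hμ
        exact this.not_gt hμ
    · by_cases hlow : c ≤ 1 / lam l
      · refine ⟨Set.Ioi (c * lam l), isPreconnected_Ioi, fun j => ?_, fun μ hμ i h => ?_⟩
        · rw [closure_Ioi]
          rw [le_div_iff₀ hl0] at hlow
          exact hlow.trans (h1 j)
        · rw [Set.mem_Ioi, h] at hμ
          exact (mul_le_mul_of_nonneg_left (h2 i) hpos.le).not_gt hμ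
      · have hup : lam l ≤ c := by
          by_contra! h
          exact hc' ⟨not_le.mp hlow, h⟩
        refine ⟨Set.Iio c, isPreconnected_Iio, fun j => ?_, fun μ hμ i h => ?_⟩
        · rw [closure_Iio]
          exact (h2 j).trans hup
        · rw [Set.mem_Iio, h] at hμ
          exact (le_mul_of_one_le_right hpos.le (h1 i)).not_gt hμ
  refine (sign_const_on_closure continuous_expDet_exp hs fun μ hμ =>
    expDet_exp_ne_zero hu hv hc hlam.injective (hsi μ hμ)).imp
    (fun h j => h _ (hsj j)) (fun h j => h _ (hsj j))

/-- For `c < 1` the largest exponent exceeds every `c * lam i`, and for `c > 1` the smallest one is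
below them. This is why positivity of the first and last weights suffices later. -/
lemma expDet_exp_first_or_last_ne_zero (hlam : StrictMono lam) {f l : Fin τ} (hf : ∀ i, f ≤ i)
    (hl : ∀ i, i ≤ l) (hone : lam f = 1) (hc : c ≠ 0) (hc1 : c ≠ 1) (hv : v = c • u)
    (hu : Function.Injective u) :
    (expDet lam v fun t => Real.exp (lam f * u t)) ≠ 0 ∨
      (expDet lam v fun t => Real.exp (lam l * u t)) ≠ 0 := by
  have h1 : ∀ i, 1 ≤ lam i := fun i => hone ▸ hlam.monotone (hf i)
  have h2 : ∀ i, lam i ≤ lam l := fun i => hlam.monotone (hl i)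
  rcases hc1.lt_or_gt with h | h
  · refine Or.inr (expDet_exp_ne_zero hu hv hc hlam.injective fun i => ?_)
    nlinarith [h1 i, h2 i]
  · refine Or.inl (expDet_exp_ne_zero hu hv hc hlam.injective fun i => ?_)
    nlinarith [h1 i]

/-! ### Counting the zeros along a ray -/

lemma encard_zeros_expDet_ray {p : Fin (τ + 1) → ℝ} {c₀ : ℝ} (h : expDet lam (c₀ • u) p ≠ 0) :
    {c : ℝ | expDet lam (c • u) p = 0}.encard + 1 ≤ (τ + 1).factorial := by
  -- The Leibniz expansion has one exponential in `c` per pair of a column and a permutation of the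
  -- rest, hence `(τ + 1) * τ! = (τ + 1)!` terms.
  have key : ∀ c : ℝ, expDet lam (c • u) p =
      expSum (fun k : Fin (τ + 1) × Equiv.Perm (Fin τ) =>
          ∑ i, lam (k.2 i) * u (k.1.succAbove i))
        (fun k => p k.1 * ((-1) ^ (k.1 : ℕ) * (Equiv.Perm.sign k.2 : ℤ))) c := by
    intro c
    rw [expDet_eq_sum, expSum, Fintype.sum_prod_type]
    refine Finset.sum_congr rfl fun t _ => ?_
    rw [expCofactor, Matrix.det_apply', Finset.mul_sum, Finset.mul_sum]
    refine Finset.sum_congr rfl fun σ _ => ?_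
    simp only [Matrix.of_apply, ← Real.exp_sum, Pi.smul_apply, smul_eq_mul]
    rw [Finset.sum_mul, ← mul_assoc, ← mul_assoc, ← mul_assoc]
    congr 2
    exact Finset.sum_congr rfl fun i _ => by ring
  simp only [key] at h ⊢
  refine (encard_zeros_expSum_lt_of_ne_zero h).trans ?_
  simp [Fintype.card_perm, Nat.factorial_succ]

lemma expDet_ray_zero (hτ : 2 ≤ τ) (p : Fin (τ + 1) → ℝ) : expDet lam ((0 : ℝ) • u) p = 0 := by
  have := Fin.nontrivial_iff_two_le.mpr hτ
  obtain ⟨i, j, hij⟩ := exists_pair_ne (Fin τ)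
  exact Matrix.det_zero_of_row_eq (fun h => hij (Fin.succ_injective _ h)) (by ext t; simp)

lemma expDet_comp_perm (σ : Equiv.Perm (Fin (τ + 1))) (g : Fin (τ + 1) → ℝ) :
    expDet lam (v ∘ σ) (g ∘ σ) = (Equiv.Perm.sign σ : ℤ) * expDet lam v g := by
  rw [expDet, expDet, ← Matrix.det_permute']
  congr 1
  ext i t
  refine Fin.cases ?_ (fun i => ?_) i <;> simp

end

/-- The six Leibniz terms, grouped by decreasing exponent, have signs `+`, `- -`, `+ +`, `-`: three
sign changes, whatever the order inside a group. The thresholds `θ₃ > θ₂ > θ₁` separate the groups.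
-/
lemma encard_zeros_expDet_ray_three_of_strictMono {lam : Fin 2 → ℝ} {u p : Fin 3 → ℝ}
    (h0 : 0 < lam 0) (h1 : lam 0 < lam 1) (hu : StrictMono u) (hp : ∀ t, 0 < p t) :
    {c : ℝ | expDet lam (c • u) p = 0}.encard ≤ 3 := by
  obtain ⟨a, ha⟩ : ∃ a, u 0 = a := ⟨_, rfl⟩
  obtain ⟨b, hb⟩ : ∃ a, u 1 = a := ⟨_, rfl⟩
  obtain ⟨d, hd⟩ : ∃ a, u 2 = a := ⟨_, rfl⟩
  have hab : a < b := ha ▸ hb ▸ hu (by decide)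
  have hbd : b < d := hb ▸ hd ▸ hu (by decide)
  generalize hl : lam 0 = l at *
  generalize hm : lam 1 = m at *
  have key : ∀ c : ℝ, expDet lam (c • u) p =
      expSum ![l * b + m * d, l * d + m * b, l * a + m * d, l * d + m * a, l * a + m * b,
        l * b + m * a] ![p 0, -p 0, -p 1, p 1, p 2, -p 2] c := by
    intro c
    rw [expDet_eq_sum]
    simp only [expSum, Fin.sum_univ_succ, expCofactor, Matrix.det_fin_two]
    simp [Fin.succAbove, hl, hm, ha, hb, hd, add_mul, Real.exp_add]
    ring_nf
  have hp0 := hp 0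
  have hp1 := hp 1
  have hp2 := hp 2
  have hx : 0 < (m - l) * (b - a) := mul_pos (by linarith) (by linarith)
  have hy : 0 < (m - l) * (d - b) := mul_pos (by linarith) (by linarith)
  have hz : 0 < l * (b - a) := mul_pos (by linarith) (by linarith)
  have hw : 0 < l * (d - b) := mul_pos (by linarith) (by linarith)
  obtain ⟨θ₃, h31, h32⟩ := exists_between
    (show max (l * d + m * b) (l * a + m * d) < l * b + m * d from
      max_lt (by nlinarith) (by nlinarith))
  obtain ⟨θ₂, h21, h22⟩ := exists_between
    (show max (l * d + m * a) (l * a + m * b) < min (l * d + m * b) (l * a + m * d) from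
      max_lt (lt_min (by nlinarith) (by nlinarith)) (lt_min (by nlinarith) (by nlinarith)))
  obtain ⟨θ₁, h11, h12⟩ := exists_between
    (show l * b + m * a < min (l * d + m * a) (l * a + m * b) from
      lt_min (by nlinarith) (by nlinarith))
  simp only [max_lt_iff, lt_min_iff] at *
  have pos : ∀ {p x y z : ℝ}, 0 < p → 0 < x → 0 < y → 0 < z → 0 < p * (x * (y * z)) :=
    fun hp hx hy hz => by positivity
  simp only [key]
  refine (encard_zeros_expSum_le_length _ [θ₁, θ₂, θ₃] _ ?_ ⟨0, ?_⟩).trans (by simp)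
  · intro k
    fin_cases k <;> simp
    · exact (pos hp0 (by linarith) (by linarith) (by linarith)).le
    · linarith [pos hp0 (show 0 < l * d + m * b - θ₁ by linarith)
        (show 0 < l * d + m * b - θ₂ by linarith) (show 0 < -(l * d + m * b - θ₃) by linarith)]
    · linarith [pos hp1 (show 0 < l * a + m * d - θ₁ by linarith)
        (show 0 < l * a + m * d - θ₂ by linarith) (show 0 < -(l * a + m * d - θ₃) by linarith)]
    · linarith [pos hp1 (show 0 < l * d + m * a - θ₁ by linarith)
        (show 0 < -(l * d + m * a - θ₂) by linarith) (show 0 < -(l * d + m * a - θ₃) by linarith)]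
    · linarith [pos hp2 (show 0 < l * a + m * b - θ₁ by linarith)
        (show 0 < -(l * a + m * b - θ₂) by linarith) (show 0 < -(l * a + m * b - θ₃) by linarith)]
    · linarith [pos hp2 (show 0 < -(l * b + m * a - θ₁) by linarith)
        (show 0 < -(l * b + m * a - θ₂) by linarith) (show 0 < -(l * b + m * a - θ₃) by linarith)]
  · simpa using pos hp0 (show 0 < l * b + m * d - θ₁ by linarith)
      (show 0 < l * b + m * d - θ₂ by linarith) (show 0 < l * b + m * d - θ₃ by linarith)

lemma encard_zeros_expDet_ray_three {lam : Fin 2 → ℝ} {u p : Fin 3 → ℝ}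
    (h0 : 0 < lam 0) (h1 : lam 0 < lam 1) (hu : Function.Injective u) (hp : ∀ t, 0 < p t) :
    {c : ℝ | expDet lam (c • u) p = 0}.encard ≤ 3 := by
  have hmono : StrictMono (u ∘ Tuple.sort u) :=
    (Tuple.monotone_sort u).strictMono_of_injective (hu.comp (Equiv.injective _))
  have := encard_zeros_expDet_ray_three_of_strictMono (p := p ∘ Tuple.sort u) h0 h1 hmono
    fun t => hp _
  refine le_of_eq_of_le ?_ this
  congr 1
  ext c
  have h2 : c • (u ∘ Tuple.sort u) = (c • u) ∘ Tuple.sort u := rfl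
  simp [h2, expDet_comp_perm]

/-! ### The conditional moment -/

section
variable {Ω : Type*} [MeasurableSpace Ω] {P : Measure Ω} {τ K : ℕ}
  {hτ : 2 ≤ τ} {Y : Ω → Fin (τ + 1) → Fin 2} {X : Ω → Regressors (τ + 1) K} {γ : Ω → ℝ}
  {ε : Ω → Fin (τ + 1) → ℝ} {β₀ : Fin K → ℝ} {F : ℝ → ℝ} {lam w : Fin τ → ℝ}

/-- The probability, given regressors `x` and fixed effect `g`, that the only positive outcome is
in period `t`. -/
noncomputable def singleProb (β₀ : Fin K → ℝ) (F : ℝ → ℝ) (t : Fin (τ + 1))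
    (x : Regressors (τ + 1) K) (g : ℝ) : ℝ :=
  ∏ s, if s = t then F (x s ⬝ᵥ β₀ + g) else 1 - F (x s ⬝ᵥ β₀ + g)

lemma IsBinaryChoicePanel.cdf_mem_Icc (h : IsBinaryChoicePanel P Y X γ ε β₀ F) (u : ℝ) :
    F u ∈ Set.Icc 0 1 :=
  h.cdf_eq 0 u ▸ ⟨cdf_nonneg _ _, cdf_le_one _ _⟩

lemma IsBinaryChoicePanel.measurable_cdf (h : IsBinaryChoicePanel P Y X γ ε β₀ F) :
    Measurable F := by
  rw [← funext (h.cdf_eq 0)]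
  exact (monotone_cdf _).measurable

lemma IsBinaryChoicePanel.measurable_Y (h : IsBinaryChoicePanel P Y X γ ε β₀ F) :
    Measurable Y := by
  have hX := h.measurable_X
  have hγ := h.measurable_γ
  have hε := h.measurable_ε
  refine measurable_pi_iff.mpr fun t => ?_
  simp only [h.outcome]
  refine Measurable.ite (measurableSet_le measurable_const ?_) measurable_const measurable_const
  unfold dotProduct
  fun_prop

lemma IsGenLogistic.odds_pos (hF : IsGenLogistic hτ lam w F) (u : ℝ) : 0 < F u / (1 - F u) := by
  rw [hF.odds]
  exact Finset.sum_pos' (fun j _ => mul_nonneg (hF.w_nonneg j) (Real.exp_pos _).le)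
    ⟨⟨0, by omega⟩, Finset.mem_univ _, mul_pos hF.w_first (Real.exp_pos _)⟩

lemma IsBinaryChoicePanel.cdf_lt_one (h : IsBinaryChoicePanel P Y X γ ε β₀ F)
    (hF : IsGenLogistic hτ lam w F) (u : ℝ) : F u < 1 := by
  refine (h.cdf_mem_Icc u).2.lt_of_ne fun h1 => ?_
  have := hF.odds_pos u
  simp [h1] at this

lemma singleProb_mem_Icc (h : IsBinaryChoicePanel P Y X γ ε β₀ F) (t : Fin (τ + 1))
    (x : Regressors (τ + 1) K) (g : ℝ) : singleProb β₀ F t x g ∈ Set.Icc 0 1 := by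
  have hF := fun u => h.cdf_mem_Icc u
  constructor
  · refine Finset.prod_nonneg fun s _ => ?_
    split_ifs
    · exact (hF _).1
    · linarith [(hF (x s ⬝ᵥ β₀ + g)).2]
  · refine Finset.prod_le_one (fun s _ => ?_) fun s _ => ?_ <;> split_ifs <;>
      linarith [(hF (x s ⬝ᵥ β₀ + g)).2, (hF (x s ⬝ᵥ β₀ + g)).1]

lemma measurable_singleProb (h : IsBinaryChoicePanel P Y X γ ε β₀ F) (t : Fin (τ + 1)) :
    Measurable fun p : Regressors (τ + 1) K × ℝ => singleProb β₀ F t p.1 p.2 := by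
  unfold singleProb
  have hF := h.measurable_cdf
  refine Finset.measurable_fun_prod _ fun s _ => ?_
  have : Measurable fun p : Regressors (τ + 1) K × ℝ => F (p.1 s ⬝ᵥ β₀ + p.2) := by
    refine hF.comp ?_
    unfold dotProduct
    fun_prop
  split_ifs
  · exact this
  · exact measurable_const.sub this

lemma outcome_eq_single_iff (h : IsBinaryChoicePanel P Y X γ ε β₀ F) (t : Fin (τ + 1)) (ω : Ω) :
    Y ω = Pi.single t 1 ↔ ∀ s, ε ω s ≤ X ω s ⬝ᵥ β₀ + γ ω ↔ s = t := by
  rw [funext_iff]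
  refine forall_congr' fun s => ?_
  rw [h.outcome, Pi.single_apply, ← sub_nonneg (b := ε ω s)]
  by_cases h1 : 0 ≤ X ω s ⬝ᵥ β₀ + γ ω - ε ω s <;> by_cases h2 : s = t <;> simp [h1, h2]

/-- The probability is the odds at `t` times `∏ s, (1 - F)`. The product is common to all periods,
so `t` enters only through `exp (lam j * x_t'β₀)`. -/
lemma singleProb_eq (h : IsBinaryChoicePanel P Y X γ ε β₀ F)
    (hF : IsGenLogistic hτ lam w F) (t : Fin (τ + 1)) (x : Regressors (τ + 1) K) (g : ℝ) :
    singleProb β₀ F t x g = ∑ j, Real.exp (lam j * (x t ⬝ᵥ β₀)) *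
      (w j * Real.exp (lam j * g) * ∏ s, (1 - F (x s ⬝ᵥ β₀ + g))) := by
  have hne : 1 - F (x t ⬝ᵥ β₀ + g) ≠ 0 := by linarith [h.cdf_lt_one hF (x t ⬝ᵥ β₀ + g)]
  have h1 : singleProb β₀ F t x g =
      F (x t ⬝ᵥ β₀ + g) / (1 - F (x t ⬝ᵥ β₀ + g)) * ∏ s, (1 - F (x s ⬝ᵥ β₀ + g)) := by
    rw [singleProb, Fintype.prod_eq_mul_prod_compl t, Fintype.prod_eq_mul_prod_compl t,
      if_pos rfl, ← mul_assoc, div_mul_cancel₀ _ hne]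
    congr 1
    refine Finset.prod_congr rfl fun s hs => if_neg ?_
    simpa using hs
  rw [h1, hF.odds, Finset.sum_mul]
  refine Finset.sum_congr rfl fun j _ => ?_
  rw [mul_add, Real.exp_add]
  ring

variable [IsProbabilityMeasure P]

lemma IsBinaryChoicePanel.isProbabilityMeasure_map
    (h : IsBinaryChoicePanel P Y X γ ε β₀ F) (t : Fin (τ + 1)) :
    IsProbabilityMeasure (P.map fun ω => ε ω t) :=
  Measure.isProbabilityMeasure_map ((measurable_pi_apply t).comp h.measurable_ε).aemeasurable

lemma map_ε_pattern (h : IsBinaryChoicePanel P Y X γ ε β₀ F) (t : Fin (τ + 1))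
    (x : Regressors (τ + 1) K) (g : ℝ) :
    P.map ε {e | ∀ s, e s ≤ x s ⬝ᵥ β₀ + g ↔ s = t} = ENNReal.ofReal (singleProb β₀ F t x g) := by
  have := h.isProbabilityMeasure_map
  have hset : {e : Fin (τ + 1) → ℝ | ∀ s, e s ≤ x s ⬝ᵥ β₀ + g ↔ s = t} =
      Set.univ.pi fun s =>
        if s = t then Set.Iic (x s ⬝ᵥ β₀ + g) else Set.Ioi (x s ⬝ᵥ β₀ + g) := by
    ext e
    simp only [Set.mem_ofPred_eq, Set.mem_pi, Set.mem_univ, true_implies]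
    refine forall_congr' fun s => ?_
    split_ifs with hs <;> simp [hs]
  have hpi := (iIndepFun_iff_map_fun_eq_pi_map
    (fun s => ((measurable_pi_apply s).comp h.measurable_ε).aemeasurable)).mp h.iIndep
  change P.map ε = Measure.pi fun s => P.map fun ω => ε ω s at hpi
  rw [hset, hpi, Measure.pi_pi, singleProb, ENNReal.ofReal_prod_of_nonneg]
  · refine Finset.prod_congr rfl fun s _ => ?_
    split_ifs
    · rw [← h.cdf_eq s, ofReal_cdf]
    · rw [← Set.compl_Iic, prob_compl_eq_one_sub measurableSet_Iic, ← ofReal_cdf, h.cdf_eq s,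
        ENNReal.ofReal_sub _ (h.cdf_mem_Icc _).1, ENNReal.ofReal_one]
  · intro s _
    split_ifs
    · exact (h.cdf_mem_Icc _).1
    · linarith [(h.cdf_mem_Icc (x s ⬝ᵥ β₀ + g)).2]

/-- The probability of a single positive outcome, in period `t`, given the regressors. -/
lemma condDistrib_single (h : IsBinaryChoicePanel P Y X γ ε β₀ F) (t : Fin (τ + 1)) :
    ∀ᵐ x ∂(P.map X), condDistrib Y X P x {Pi.single t 1} =
      ∫⁻ g, ENNReal.ofReal (singleProb β₀ F t x g) ∂(condDistrib γ X P x) := by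
  have hX := h.measurable_X
  have hγ := h.measurable_γ
  have hε := h.measurable_ε
  have hY := h.measurable_Y
  have := Measure.isProbabilityMeasure_map (μ := P) hX.aemeasurable
  have := Measure.isProbabilityMeasure_map (μ := P) hε.aemeasurable
  have hm : Measurable fun p : Regressors (τ + 1) K × ℝ =>
      ENNReal.ofReal (singleProb β₀ F t p.1 p.2) := (measurable_singleProb h t).ennreal_ofReal
  -- Integrated over `X ∈ A`, both sides become the probability that `X ∈ A` and only period `t` is
  -- positive; independence of `(X, γ)` and `ε` yields the right-hand one by Tonelli.
  refine ae_eq_of_forall_setLIntegral_eq_of_sigmaFinite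
    (Kernel.measurable_coe _ (measurableSet_singleton _)) hm.lintegral_kernel_prod_right
    fun A hA _ => ?_
  rw [setLIntegral_map hA (Kernel.measurable_coe _ (measurableSet_singleton _)) hX,
    setLIntegral_preimage_condDistrib hX hY.aemeasurable (measurableSet_singleton _) hA]
  have hR : ∫⁻ x in A, ∫⁻ g, ENNReal.ofReal (singleProb β₀ F t x g) ∂(condDistrib γ X P x)
      ∂(P.map X) = ∫⁻ p in A ×ˢ Set.univ, ENNReal.ofReal (singleProb β₀ F t p.1 p.2)
        ∂(P.map fun ω => (X ω, γ ω)) := by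
    rw [← compProd_map_condDistrib hγ.aemeasurable,
      Measure.setLIntegral_compProd hm hA MeasurableSet.univ]
    simp
  rw [hR]
  set S : Set ((Regressors (τ + 1) K × ℝ) × (Fin (τ + 1) → ℝ)) :=
    {q | q.1.1 ∈ A ∧ ∀ s, q.2 s ≤ q.1.1 s ⬝ᵥ β₀ + q.1.2 ↔ s = t} with hS
  have hpat : MeasurableSet {q : (Regressors (τ + 1) K × ℝ) × (Fin (τ + 1) → ℝ) |
      ∀ s, q.2 s ≤ q.1.1 s ⬝ᵥ β₀ + q.1.2 ↔ s = t} := by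
    rw [Set.ofPred_forall]
    refine MeasurableSet.iInter fun s => MeasurableSet.iff (measurableSet_le ?_ ?_)
      (MeasurableSet.const _)
    · fun_prop
    · unfold dotProduct
      fun_prop
  have hSm : MeasurableSet S :=
    MeasurableSet.inter (hA.preimage (measurable_fst.comp measurable_fst)) hpat
  have hev : X ⁻¹' A ∩ Y ⁻¹' {Pi.single t 1} = (fun ω => ((X ω, γ ω), ε ω)) ⁻¹' S := by
    ext ω
    simp [hS, outcome_eq_single_iff h]
  have hprod := (indepFun_iff_map_prod_eq_prod_map_map (hX.prodMk hγ).aemeasurable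
    hε.aemeasurable).mp h.indep
  rw [hev, ← Measure.map_apply ((hX.prodMk hγ).prodMk hε) hSm, hprod,
    Measure.prod_apply hSm, ← lintegral_indicator (hA.prod MeasurableSet.univ)]
  refine lintegral_congr fun p => ?_
  by_cases hp : p.1 ∈ A
  · rw [Set.indicator_of_mem (by simpa using hp), ← map_ε_pattern h]
    congr 1
    ext e
    simp [hS, hp]
  · rw [Set.indicator_of_notMem (by simpa using hp)]
    have : Prod.mk p ⁻¹' S = ∅ := by
      ext e
      simp [hS, hp]
    simp [this]

lemma condMoment_eq_sum (b : Fin K → ℝ) (x : Regressors (τ + 1) K) :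
    condMoment P Y X lam b x =
      expDet lam (fun t => x t ⬝ᵥ b) fun t => (condDistrib Y X P x).real {Pi.single t 1} := by
  rw [condMoment, expDet_eq_sum]
  unfold momentFun
  rw [integral_finsetSum _ fun t _ => Integrable.of_finite]
  refine Finset.sum_congr rfl fun t _ => ?_
  have : (fun y : Fin (τ + 1) → Fin 2 =>
      if y t = 1 ∧ ∀ t', t' ≠ t → y t' = 0 then minorM lam t x b else 0) =
      Set.indicator {Pi.single t 1} fun _ => minorM lam t x b := by
    ext y
    have hy : (y t = 1 ∧ ∀ t', t' ≠ t → y t' = 0) ↔ y = Pi.single t 1 := by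
      constructor
      · rintro ⟨h1, h2⟩
        ext s
        by_cases hs : s = t
        · subst hs; simp [h1]
        · simp [hs, h2 s hs]
      · rintro rfl
        exact ⟨by simp, fun s hs => by simp [hs]⟩
    simp only [hy, Set.indicator_apply, Set.mem_singleton_iff]
  rw [this, integral_indicator_const _ (measurableSet_singleton _)]
  rfl

/-- The conditional moment is a combination of the determinants `D_j`, with nonnegative weights
which are positive where `w` is. -/
lemma exists_condMoment_eq (h : IsBinaryChoicePanel P Y X γ ε β₀ F)
    (hF : IsGenLogistic hτ lam w F) :
    ∀ᵐ ω ∂P, ∃ a : Fin τ → ℝ, (∀ j, 0 ≤ a j) ∧ (∀ j, 0 < w j → 0 < a j) ∧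
      ∀ b, condMoment P Y X lam b (X ω) = expDet lam (fun t => X ω t ⬝ᵥ b)
        (fun t => ∑ j, a j * Real.exp (lam j * (X ω t ⬝ᵥ β₀))) := by
  refine ae_of_ae_map h.measurable_X.aemeasurable
    (p := fun x => ∃ a : Fin τ → ℝ, (∀ j, 0 ≤ a j) ∧ (∀ j, 0 < w j → 0 < a j) ∧
      ∀ b, condMoment P Y X lam b x = expDet lam (fun t => x t ⬝ᵥ b)
        (fun t => ∑ j, a j * Real.exp (lam j * (x t ⬝ᵥ β₀)))) ?_
  filter_upwards [ae_all_iff.mpr (condDistrib_single h)] with x hx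
  have hFm := h.measurable_cdf
  set κ := condDistrib γ X P x
  set f : Fin τ → ℝ → ℝ := fun j g =>
    w j * Real.exp (lam j * g) * ∏ s, (1 - F (x s ⬝ᵥ β₀ + g)) with hf
  have hC : ∀ g, 0 < ∏ s, (1 - F (x s ⬝ᵥ β₀ + g)) := fun g =>
    Finset.prod_pos fun s _ => by linarith [h.cdf_lt_one hF (x s ⬝ᵥ β₀ + g)]
  have hf0 : ∀ j g, 0 ≤ f j g := fun j g =>
    mul_nonneg (mul_nonneg (hF.w_nonneg j) (Real.exp_pos _).le) (hC g).le
  have hfm : ∀ j, Measurable (f j) := fun j => by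
    refine Measurable.mul (by fun_prop) (Finset.measurable_fun_prod _ fun s _ => ?_)
    exact measurable_const.sub (hFm.comp (by fun_prop))
  -- Up to a factor free of `g`, `f j g` is one nonnegative summand of a probability. It is
  -- therefore bounded, hence integrable with no moment condition on `γ`.
  have hfle : ∀ j g, Real.exp (lam j * (x 0 ⬝ᵥ β₀)) * f j g ≤ 1 := fun j g => by
    refine le_trans ?_ (singleProb_mem_Icc h 0 x g).2
    rw [singleProb_eq h hF]
    exact Finset.single_le_sum (f := fun j => Real.exp (lam j * (x 0 ⬝ᵥ β₀)) * f j g)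
      (fun i _ => mul_nonneg (Real.exp_pos _).le (hf0 i g)) (Finset.mem_univ j)
  have hfi : ∀ j, Integrable (f j) κ := fun j => by
    refine Integrable.of_bound (hfm j).aestronglyMeasurable
      (Real.exp (lam j * (x 0 ⬝ᵥ β₀)))⁻¹ (Filter.Eventually.of_forall fun g => ?_)
    rw [Real.norm_of_nonneg (hf0 j g), ← one_div, le_div_iff₀' (Real.exp_pos _)]
    exact hfle j g
  refine ⟨fun j => ∫ g, f j g ∂κ, fun j => integral_nonneg (hf0 j), fun j hj => ?_, fun b => ?_⟩
  · rw [integral_pos_iff_support_of_nonneg (hf0 j) (hfi j)]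
    have : Function.support (f j) = Set.univ := by
      ext g
      simpa [hf] using (mul_pos (mul_pos hj (Real.exp_pos (lam j * g))) (hC g)).ne'
    simp [this]
  · rw [condMoment_eq_sum]
    congr 1
    ext t
    have h0 : 0 ≤ᵐ[κ] fun g => singleProb β₀ F t x g :=
      Filter.Eventually.of_forall fun g => (singleProb_mem_Icc h t x g).1
    rw [measureReal_def, hx t, ← integral_eq_lintegral_of_nonneg_ae h0
      ((measurable_singleProb h t).comp measurable_prodMk_left).aestronglyMeasurable]
    simp only [singleProb_eq h hF]
    rw [integral_finsetSum _ fun j _ => (hfi j).const_mul _]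
    refine Finset.sum_congr rfl fun j _ => ?_
    rw [integral_const_mul, mul_comm]

end

open Filter Topology

/-! ### Perturbation of trajectories -/

lemma eventually_affine_ne_zero (A : ℝ) {B : ℝ} (hB : B ≠ 0) : ∀ᶠ η in 𝓝[≠] (0 : ℝ),
    A + η * B ≠ 0 := by
  by_cases hA : A = 0
  · filter_upwards [self_mem_nhdsWithin] with η hη
    simpa [hA, hB] using hη
  · have : ContinuousAt (fun η : ℝ => A + η * B) 0 := by fun_prop
    exact (this.eventually_ne (by simpa using hA)).filter_mono nhdsWithin_le_nhds

lemma eventually_separated {ι : Type*} [Finite ι] (v n : ι → ℝ) : ∀ᶠ η in 𝓝[≠] (0 : ℝ),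
    ∀ r r', n r ≠ n r' → v r + η * n r ≠ v r' + η * n r' := by
  rw [eventually_all]
  intro r
  rw [eventually_all]
  intro r'
  by_cases h : n r = n r'
  · simp [h]
  · filter_upwards [eventually_affine_ne_zero (v r - v r') (sub_ne_zero.mpr h)] with η hη _ heq
    exact hη (by linarith)

lemma eventually_add_smul_mem {E : Type*} [AddCommGroup E] [Module ℝ E] [TopologicalSpace E]
    [ContinuousAdd E] [ContinuousSMul ℝ E] {U : Set E} (hU : IsOpen U) {z : E} (hz : z ∈ U)
    (d : E) : ∀ᶠ η in 𝓝[≠] (0 : ℝ), z + η • d ∈ U := by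
  have : ContinuousAt (fun η : ℝ => z + η • d) 0 := by fun_prop
  exact (this.eventually_mem (by simpa using hU.mem_nhds hz)).filter_mono nhdsWithin_le_nhds

section
variable {τ K : ℕ} {lam : Fin τ → ℝ} {β₀ b : Fin K → ℝ}

lemma exists_mem_injective_dotProduct {U : Set (Regressors (τ + 1) K)} (hU : IsOpen U)
    {z : Regressors (τ + 1) K} (hz : z ∈ U) (hb : b ≠ 0) :
    ∃ x ∈ U, Function.Injective fun t => x t ⬝ᵥ b := by
  have hbb : b ⬝ᵥ b ≠ 0 := fun h => hb (dotProduct_self_eq_zero.mp h)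
  obtain ⟨η, hη, hmem⟩ := ((eventually_separated (fun t => z t ⬝ᵥ b)
    (fun t : Fin (τ + 1) => (t : ℝ) * (b ⬝ᵥ b))).and
      (eventually_add_smul_mem hU hz (fun t => (t : ℝ) • b))).exists
  refine ⟨_, hmem, fun r r' h => ?_⟩
  by_contra hne
  refine hη r r' (fun h => hne ?_) ?_
  · exact Fin.ext (Nat.cast_injective (mul_right_cancel₀ hbb h))
  · simpa [add_dotProduct] using h

lemma detD_eq_expDet (j : Fin τ) (x : Regressors (τ + 1) K) :
    detD lam β₀ j x b = expDet lam (fun t => x t ⬝ᵥ b)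
      fun t => Real.exp (lam j * (x t ⬝ᵥ β₀)) := rfl

lemma continuous_detD (j : Fin τ) :
    Continuous fun x : Regressors (τ + 1) K => detD lam β₀ j x b := by
  unfold detD
  refine Continuous.matrix_det (continuous_matrix fun i t => ?_)
  refine Fin.cases ?_ (fun i => ?_) i
  · simp only [Matrix.of_apply, Fin.cons_zero]
    unfold dotProduct
    fun_prop
  · simp only [Matrix.of_apply, Fin.cons_succ]
    unfold dotProduct
    fun_prop

/-- Near a trajectory with two coinciding periods, if `b` is not proportional to `β₀`, there is a
trajectory for which all the `D_j` have the same strict sign. -/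
lemma exists_detD_same_strict_sign (hτ : 0 < τ) (hlam : Function.Injective lam)
    (hpos : ∀ i, 0 < lam i) (hβ₀ : β₀ ≠ 0) (hb : b ≠ 0)
    (hβ : ∀ c : ℝ, b ≠ c • β₀) {U : Set (Regressors (τ + 1) K)} (hU : IsOpen U)
    {z : Regressors (τ + 1) K} (hz : z ∈ U) {s t : Fin (τ + 1)} (hst : s ≠ t) (hzz : z s = z t) :
    ∃ x ∈ U, (∀ j, 0 < detD lam β₀ j x b) ∨ (∀ j, detD lam β₀ j x b < 0) := by
  have : NeZero τ := ⟨hτ.ne'⟩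
  have hbb : b ⬝ᵥ b ≠ 0 := fun h => hb (dotProduct_self_eq_zero.mp h)
  -- The component of `β₀` orthogonal to `b`: moving along it leaves `x_t'b` unchanged but alters
  -- `x_t'β₀`.
  set d : Fin K → ℝ := β₀ - ((β₀ ⬝ᵥ b) / (b ⬝ᵥ b)) • b with hd
  have hdb : d ⬝ᵥ b = 0 := by
    simp only [hd, sub_dotProduct, smul_dotProduct, smul_eq_mul]
    field_simp
    ring
  have hdβ : d ⬝ᵥ β₀ ≠ 0 := by
    intro h
    have h0 : d ⬝ᵥ d = 0 := by
      conv_lhs => rw [hd, dotProduct_sub, dotProduct_smul, ← hd]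
      simp [h, hdb]
    have hd0 := dotProduct_self_eq_zero.mp h0
    rw [hd, sub_eq_zero] at hd0
    by_cases hk : (β₀ ⬝ᵥ b) / (b ⬝ᵥ b) = 0
    · exact hβ₀ (by rw [hd0, hk, zero_smul])
    · exact hβ ((β₀ ⬝ᵥ b) / (b ⬝ᵥ b))⁻¹ ((eq_inv_smul_iff₀ hk).mpr hd0.symm)
  -- Period `t` gets the label of `s`, so moving along `n r • b` keeps `x_s'b = x_t'b` and separates
  -- the indices of all periods other than `t`.
  set n : Fin (τ + 1) → ℝ := fun r => if r = t then (s : ℝ) else (r : ℝ) with hn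
  have hnst : n s = n t := by simp [hn]
  set D : Regressors (τ + 1) K := fun r => n r • b + if r = t then d else 0 with hD
  obtain ⟨η, ⟨hη, hmem⟩, hη0⟩ := ((eventually_separated (fun r => z r ⬝ᵥ b)
    (fun r => n r * (b ⬝ᵥ b))).and (eventually_add_smul_mem hU hz D)).and
      self_mem_nhdsWithin |>.exists
  set x := z + η • D with hx
  have hxb : ∀ r, x r ⬝ᵥ b = z r ⬝ᵥ b + η * (n r * (b ⬝ᵥ b)) := by
    intro r
    simp only [hx, hD, Pi.add_apply, Pi.smul_apply, add_dotProduct, smul_dotProduct, smul_eq_mul]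
    split_ifs <;> simp [hdb]
  have hxst : x s ⬝ᵥ b = x t ⬝ᵥ b := by rw [hxb, hxb, hzz, hnst]
  have hxβ : x t ⬝ᵥ β₀ = x s ⬝ᵥ β₀ + η * (d ⬝ᵥ β₀) := by
    simp only [hx, hD, Pi.add_apply, Pi.smul_apply, add_dotProduct, smul_dotProduct, smul_eq_mul,
      hzz, hnst, if_neg hst, if_pos, zero_dotProduct]
    ring
  have hne : η * (d ⬝ᵥ β₀) ≠ 0 := mul_ne_zero hη0 hdβ
  have hcof : expCofactor lam (fun r => x r ⬝ᵥ b) t ≠ 0 := by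
    refine expCofactor_ne_zero hlam fun r r' hr hr' h => ?_
    by_contra hrr
    simp only [hxb] at h
    refine hη r r' (fun h' => hrr ?_) h
    have := mul_right_cancel₀ hbb h'
    simp only [hn, if_neg hr, if_neg hr'] at this
    exact Fin.ext (Nat.cast_injective this)
  have hdet : ∀ j, detD lam β₀ j x b =
      (Real.exp (lam j * (x t ⬝ᵥ β₀)) - Real.exp (lam j * (x s ⬝ᵥ β₀))) *
        expCofactor lam (fun r => x r ⬝ᵥ b) t := fun j => by
    rw [detD_eq_expDet, expDet_of_col_eq lam _ hst hxst]
  have hup : x s ⬝ᵥ β₀ < x t ⬝ᵥ β₀ → ∀ j,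
      0 < Real.exp (lam j * (x t ⬝ᵥ β₀)) - Real.exp (lam j * (x s ⬝ᵥ β₀)) := fun h j =>
    sub_pos.mpr (Real.exp_lt_exp.mpr (mul_lt_mul_of_pos_left h (hpos j)))
  have hdn : x t ⬝ᵥ β₀ < x s ⬝ᵥ β₀ → ∀ j,
      Real.exp (lam j * (x t ⬝ᵥ β₀)) - Real.exp (lam j * (x s ⬝ᵥ β₀)) < 0 := fun h j =>
    sub_neg.mpr (Real.exp_lt_exp.mpr (mul_lt_mul_of_pos_left h (hpos j)))
  refine ⟨x, hmem, ?_⟩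
  simp only [hdet]
  rcases hne.lt_or_gt with h1 | h1 <;> rcases hcof.lt_or_gt with h2 | h2
  · exact Or.inl fun j => mul_pos_of_neg_of_neg (hdn (by linarith) j) h2
  · exact Or.inr fun j => mul_neg_of_neg_of_pos (hdn (by linarith) j) h2
  · exact Or.inr fun j => mul_neg_of_pos_of_neg (hup (by linarith) j) h2
  · exact Or.inl fun j => mul_pos (hup (by linarith) j) h2

/-- Shifting every period by `η β₀` multiplies `D_j` by `exp (lam j * η * |β₀|²)` and a factor free
of `j`, so equal nonzero values at `f` and `l` become different. -/
lemma exists_detD_ne {f l : Fin τ} (hfl : lam f ≠ lam l) (hβ₀ : β₀ ≠ 0)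
    {U : Set (Regressors (τ + 1) K)} (hU : IsOpen U) {x : Regressors (τ + 1) K} (hx : x ∈ U)
    (h : detD lam β₀ f x b ≠ 0 ∨ detD lam β₀ l x b ≠ 0) :
    ∃ x' ∈ U, detD lam β₀ f x' b ≠ detD lam β₀ l x' b := by
  by_cases hne : detD lam β₀ f x b = detD lam β₀ l x b
  swap
  · exact ⟨x, hx, hne⟩
  have h0 : detD lam β₀ l x b ≠ 0 := h.elim (fun h => hne ▸ h) id
  have hββ : β₀ ⬝ᵥ β₀ ≠ 0 := fun h => hβ₀ (dotProduct_self_eq_zero.mp h)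
  obtain ⟨η, hmem, hη0⟩ := ((eventually_add_smul_mem hU hx (fun _ => β₀)).and
    self_mem_nhdsWithin).exists
  refine ⟨_, hmem, fun heq => hfl ?_⟩
  have key : ∀ j, detD lam β₀ j (x + η • fun _ => β₀) b =
      Real.exp (lam j * (η * (β₀ ⬝ᵥ β₀))) * Real.exp ((∑ i, lam i) * (η * (β₀ ⬝ᵥ b))) *
        detD lam β₀ j x b := by
    intro j
    rw [detD_eq_expDet, detD_eq_expDet, ← expDet_shift]
    congr 1
    · ext t
      simp [add_dotProduct]
    · ext t
      rw [← Real.exp_add]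
      simp [add_dotProduct]
      ring
  rw [key, key, hne] at heq
  have h1 := mul_right_cancel₀ (Real.exp_pos _).ne' (mul_right_cancel₀ h0 heq)
  exact mul_right_cancel₀ (mul_ne_zero hη0 hββ) (Real.exp_injective h1)

end

/-! ### The identified set and the outer set -/

lemma exists_mem_of_measure_pos {Ω : Type*} [MeasurableSpace Ω] {P : Measure Ω} {S : Set Ω}
    (hS : 0 < P S) {p : Ω → Prop} (hp : ∀ᵐ ω ∂P, p ω) : ∃ ω ∈ S, p ω := by
  by_contra! h
  exact hS.ne' (measure_mono_null h hp)

/-- If almost surely each parameter of `C` has the property `Q`, and with positive probability at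
most `N` parameters have it, then `C` has at most `N` elements. -/
lemma encard_le_of_ae {Ω : Type*} [MeasurableSpace Ω] {P : Measure Ω} {S : Set Ω}
    (hS : 0 < P S) {α : Type*} {C : Set α} {Q : α → Ω → Prop} (hC : ∀ c ∈ C, ∀ᵐ ω ∂P, Q c ω)
    {N : ℕ} (hN : ∀ᵐ ω ∂P, ω ∈ S → {c | Q c ω}.encard ≤ N) : C.encard ≤ N := by
  by_contra! hlt
  obtain ⟨s, hsC, hs⟩ := Set.exists_subset_encard_eq (Order.add_one_le_of_lt hlt)
  have hsf : s.Finite := Set.finite_of_encard_eq_coe (k := N + 1) (by rw [hs]; push_cast; rfl)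
  obtain ⟨ω, hω, h1, h2⟩ := exists_mem_of_measure_pos hS
    (hN.and ((ae_ball_iff hsf.countable).mpr fun c hc => hC c (hsC hc)))
  have h3 := (Set.encard_le_encard h2).trans (h1 hω)
  rw [hs] at h3
  have h4 : N + 1 ≤ N := by exact_mod_cast h3
  omega

lemma sum_mul_ne_zero_of_same_sign {ι : Type*} [Fintype ι] {a D : ι → ℝ} (ha : ∀ j, 0 ≤ a j)
    (hD : (∀ j, 0 ≤ D j) ∨ (∀ j, D j ≤ 0)) {j : ι} (hj : 0 < a j) (hDj : D j ≠ 0) :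
    ∑ j, a j * D j ≠ 0 := by
  rcases hD with h | h
  · exact (Finset.sum_pos' (fun i _ => mul_nonneg (ha i) (h i))
      ⟨j, Finset.mem_univ _, mul_pos hj ((h j).lt_of_ne' hDj)⟩).ne'
  · exact (Finset.sum_neg' (fun i _ => mul_nonpos_of_nonneg_of_nonpos (ha i) (h i))
      ⟨j, Finset.mem_univ _, mul_neg_of_pos_of_neg hj ((h j).lt_of_ne hDj)⟩).ne

/-! ### Zeros of the weighted moment along a ray -/

section
variable {τ : ℕ} {lam a : Fin τ → ℝ} {u : Fin (τ + 1) → ℝ} {f l : Fin τ}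

/-- The multiplier `lam l + 1` is beyond the interval, where the determinants share a sign and the
first one is nonzero. It certifies that the moment does not vanish identically in `c`. -/
lemma expDet_ray_ne_zero (hlam : StrictMono lam) (hf : ∀ i, f ≤ i)
    (hl : ∀ i, i ≤ l) (hone : lam f = 1) (hu : Function.Injective u) (ha : ∀ j, 0 ≤ a j)
    (haf : 0 < a f) :
    expDet lam ((lam l + 1) • u) (fun t => ∑ j, a j * Real.exp (lam j * u t)) ≠ 0 := by
  have h1 : ∀ i, 1 ≤ lam i := fun i => hone ▸ hlam.monotone (hf i)
  have := h1 l
  rw [expDet_sum lam _ Finset.univ a fun j t => Real.exp (lam j * u t)]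
  refine sum_mul_ne_zero_of_same_sign ha (expDet_exp_same_sign hlam hf hl hone ?_ ?_ rfl) haf
    (expDet_exp_ne_zero hu rfl ?_ hlam.injective fun i => ?_)
  · linarith
  · exact fun h => by linarith [h.2]
  · linarith
  · nlinarith [h1 i]

lemma encard_nonzero_ray_le (hτ : 2 ≤ τ) (hlam : StrictMono lam) (hf : ∀ i, f ≤ i)
    (hl : ∀ i, i ≤ l) (hone : lam f = 1) (hu : Function.Injective u) (ha : ∀ j, 0 ≤ a j)
    (haf : 0 < a f) :
    {c : ℝ | c ≠ 0 ∧ expDet lam (c • u) (fun t => ∑ j, a j * Real.exp (lam j * u t)) = 0}.encard ≤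
      ((if τ = 2 then 2 else (τ + 1).factorial - 1 : ℕ) : ℕ∞) := by
  set p : Fin (τ + 1) → ℝ := fun t => ∑ j, a j * Real.exp (lam j * u t)
  have hp : ∀ t, 0 < p t := fun t =>
    Finset.sum_pos' (fun j _ => mul_nonneg (ha j) (Real.exp_pos _).le)
      ⟨f, Finset.mem_univ _, mul_pos haf (Real.exp_pos _)⟩
  have hins : {c : ℝ | c ≠ 0 ∧ expDet lam (c • u) p = 0}.encard + 1 ≤
      {c : ℝ | expDet lam (c • u) p = 0}.encard := by
    rw [← Set.encard_insert_of_notMem (a := (0 : ℝ)) (by simp)]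
    refine Set.encard_le_encard (Set.insert_subset (expDet_ray_zero hτ p) fun c hc => hc.2)
  split_ifs with h2
  · subst h2
    have := encard_zeros_expDet_ray_three (lam := lam) (u := u) (p := p)
      (by linarith [hlam.monotone (hf 0)]) (hlam (by decide)) hu hp
    have h3 := hins.trans this
    exact (ENat.add_le_add_iff_right ENat.one_ne_top).mp h3
  · have h3 := encard_zeros_expDet_ray (expDet_ray_ne_zero hlam hf hl hone hu ha haf)
    -- Here the zero `c = 0` is not exploited fully: the bound is weakened by one to the stated
    -- form.
    have h4 := (hins.trans le_self_add).trans h3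
    have h5 : (τ + 1).factorial = ((τ + 1).factorial - 1) + 1 :=
      (Nat.sub_add_cancel (Nat.factorial_pos _)).symm
    rw [h5] at h4
    exact (ENat.add_le_add_iff_right ENat.one_ne_top).mp (by exact_mod_cast h4)

end

section
variable {Ω : Type*} [MeasurableSpace Ω] {P : Measure Ω} {τ K : ℕ}
  {hτ : 2 ≤ τ} {Y : Ω → Fin (τ + 1) → Fin 2} {X : Ω → Regressors (τ + 1) K} {γ : Ω → ℝ}
  {ε : Ω → Fin (τ + 1) → ℝ} {β₀ b : Fin K → ℝ} {F : ℝ → ℝ} {lam w : Fin τ → ℝ}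

lemma last_lt (hτ : 2 ≤ τ) : τ - 1 < τ := Nat.sub_lt (two_pos.trans_le hτ) one_pos

lemma IsGenLogistic.one_le_lam (hF : IsGenLogistic hτ lam w F) (i : Fin τ) : 1 ≤ lam i :=
  hF.lam_first ▸ hF.lam_strictMono.monotone (Fin.le_def.mpr (Nat.zero_le _))

lemma IsGenLogistic.one_lt_lam_last (hF : IsGenLogistic hτ lam w F) :
    1 < lam ⟨τ - 1, last_lt hτ⟩ :=
  hF.lam_first ▸ hF.lam_strictMono (Fin.lt_def.mpr (by simp; omega))

lemma first_le (h0 : 0 < τ) (i : Fin τ) : ⟨0, h0⟩ ≤ i :=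
  Fin.le_def.mpr (Nat.zero_le _)

lemma le_last (h1 : τ - 1 < τ) (i : Fin τ) : i ≤ ⟨τ - 1, h1⟩ :=
  Fin.le_def.mpr (by simp; omega)

lemma measure_preimage_pos (hX : Measurable X) {U : Set (Regressors (τ + 1) K)} (hU : IsOpen U)
    {x : Regressors (τ + 1) K} (hx : x ∈ U) (hxs : x ∈ supp P X) : 0 < P (X ⁻¹' U) := by
  rw [← Measure.map_apply hX hU.measurableSet]
  exact (Measure.mem_support_iff_forall x).mp hxs U (hU.mem_nhds hx)

lemma condMoment_sum_detD {a : Fin τ → ℝ} {x : Regressors (τ + 1) K} :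
    expDet lam (fun t => x t ⬝ᵥ b) (fun t => ∑ j, a j * Real.exp (lam j * (x t ⬝ᵥ β₀))) =
      ∑ j, a j * detD lam β₀ j x b :=
  expDet_sum lam _ Finset.univ a fun j t => Real.exp (lam j * (x t ⬝ᵥ β₀))

lemma mem_signSet_of_ne {x : Regressors (τ + 1) K} (hx : x ∈ supp P X) {f l : Fin τ}
    (hne : detD lam β₀ f x b ≠ detD lam β₀ l x b)
    (hs : (∀ j, 0 ≤ detD lam β₀ j x b) ∨ (∀ j, detD lam β₀ j x b ≤ 0)) :
    x ∈ signSet P X lam β₀ b := by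
  have : Nonempty (Fin τ) := ⟨f⟩
  have hb := (Set.finite_range fun j => detD lam β₀ j x b).bddBelow
  have ha := (Set.finite_range fun j => detD lam β₀ j x b).bddAbove
  have hlt : (⨅ j, detD lam β₀ j x b) < ⨆ j, detD lam β₀ j x b := by
    rcases hne.lt_or_gt with h | h
    · exact (ciInf_le hb f).trans_lt (h.trans_le (le_ciSup ha l))
    · exact (ciInf_le hb l).trans_lt (h.trans_le (le_ciSup ha f))
  exact ⟨hx, hs.imp (fun h => ⟨hlt, le_ciInf h⟩) fun h => ⟨hlt, ciSup_le h⟩⟩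

lemma notMem_outerSet (hX : Measurable X) (hβ₀ : β₀ ≠ 0) {f l : Fin τ} (hfl : lam f ≠ lam l)
    {U : Set (Regressors (τ + 1) K)} (hU : IsOpen U) (hUs : U ⊆ supp P X)
    (hs : ∀ x ∈ U, (∀ j, 0 ≤ detD lam β₀ j x b) ∨ (∀ j, detD lam β₀ j x b ≤ 0))
    {x : Regressors (τ + 1) K} (hx : x ∈ U)
    (h : detD lam β₀ f x b ≠ 0 ∨ detD lam β₀ l x b ≠ 0) : b ∉ outerSet P X lam β₀ := by
  obtain ⟨x', hx', hne⟩ := exists_detD_ne hfl hβ₀ hU hx h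
  intro hb
  have hpos := measure_preimage_pos (P := P) hX (hU.inter
    (isOpen_ne_fun (continuous_detD (lam := lam) (β₀ := β₀) (b := b) f) (continuous_detD l)))
    ⟨hx', hne⟩ (hUs hx')
  refine hpos.ne' (measure_mono_null ?_ hb.2)
  exact fun ω hω => mem_signSet_of_ne (hUs hω.1) hω.2 (hs _ hω.1)

/-- If `b` is not proportional to `β₀`, the `D_j` have the same strict sign on a nonempty open
subset of the support. -/
lemma exists_open_same_strict_sign (hF : IsGenLogistic hτ lam w F) (hβ₀ : β₀ ≠ 0) (hb : b ≠ 0)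
    (hβ : ∀ c : ℝ, b ≠ c • β₀) (hc : ContinuousRegressors P X) :
    ∃ U : Set (Regressors (τ + 1) K), IsOpen U ∧ U ⊆ supp P X ∧ U.Nonempty ∧
      ∀ x ∈ U, (∀ j, 0 < detD lam β₀ j x b) ∨ (∀ j, detD lam β₀ j x b < 0) := by
  obtain ⟨s, t, x₀, hst, z, hz, hzs, hzt⟩ := hc
  obtain ⟨x, hx, hsign⟩ := exists_detD_same_strict_sign (by omega) hF.lam_strictMono.injective
    (fun i => zero_lt_one.trans_le (hF.one_le_lam i)) hβ₀ hb hβ isOpen_interior hz hst.ne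
    (hzs.trans hzt.symm)
  refine ⟨interior (supp P X) ∩
    {x | (∀ j, 0 < detD lam β₀ j x b) ∨ (∀ j, detD lam β₀ j x b < 0)}, isOpen_interior.inter ?_,
    fun x hx => interior_subset hx.1, ⟨x, hx, hsign⟩, fun x hx => hx.2⟩
  rw [Set.ofPred_or, Set.ofPred_forall, Set.ofPred_forall]
  exact (isOpen_iInter_of_finite fun j => isOpen_lt continuous_const (continuous_detD j)).union
    (isOpen_iInter_of_finite fun j => isOpen_lt (continuous_detD j) continuous_const)

lemma detD_smul_same_sign (hF : IsGenLogistic hτ lam w F) {c : ℝ} (hc : c ≠ 0)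
    (hc' : c ∉ Set.Ioo (1 / lam ⟨τ - 1, last_lt hτ⟩) (lam ⟨τ - 1, last_lt hτ⟩))
    {x : Regressors (τ + 1) K} (hb : ∀ t, x t ⬝ᵥ b = c * (x t ⬝ᵥ β₀)) :
    (∀ j, 0 ≤ detD lam β₀ j x b) ∨ (∀ j, detD lam β₀ j x b ≤ 0) :=
  expDet_exp_same_sign (f := ⟨0, by omega⟩)
        (l := ⟨τ - 1, last_lt hτ⟩) hF.lam_strictMono (first_le _) (le_last _) hF.lam_first hc hc'
    (funext hb)

lemma detD_smul_first_or_last_ne_zero (hF : IsGenLogistic hτ lam w F) {c : ℝ} (hc : c ≠ 0)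
    (hc1 : c ≠ 1) {x : Regressors (τ + 1) K} (hb : ∀ t, x t ⬝ᵥ b = c * (x t ⬝ᵥ β₀))
    (hx : Function.Injective fun t => x t ⬝ᵥ β₀) :
    detD lam β₀ ⟨0, by omega⟩ x b ≠ 0 ∨ detD lam β₀ ⟨τ - 1, last_lt hτ⟩ x b ≠ 0 :=
  expDet_exp_first_or_last_ne_zero (f := ⟨0, by omega⟩)
        (l := ⟨τ - 1, last_lt hτ⟩) hF.lam_strictMono (first_le _) (le_last _) hF.lam_first
    hc hc1 (funext hb) hx

lemma IsGenLogistic.ne_one_of_notMem_Ioo (hF : IsGenLogistic hτ lam w F) {c : ℝ}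
    (hc : c ∉ Set.Ioo (1 / lam ⟨τ - 1, last_lt hτ⟩) (lam ⟨τ - 1, last_lt hτ⟩)) : c ≠ 1 := by
  rintro rfl
  exact hc ⟨(div_lt_one (zero_lt_one.trans hF.one_lt_lam_last)).mpr hF.one_lt_lam_last,
    hF.one_lt_lam_last⟩

/-- Otherwise the `D_j` share a weak sign on an open part of the support and one of them is nonzero;
after a small shift two of them differ, so `𝒟(b)` has positive probability. -/
theorem outerSet_subset (hX : Measurable X) (hβ₀ : β₀ ≠ 0) (hF : IsGenLogistic hτ lam w F)
    (hcont : ContinuousRegressors P X) : outerSet P X lam β₀ ⊆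
      {b | ∃ c ∈ Set.Ioo (1 / lam ⟨τ - 1, last_lt hτ⟩) (lam ⟨τ - 1, last_lt hτ⟩), b = c • β₀} := by
  intro b hb
  have hfl : lam ⟨0, by omega⟩ ≠ lam ⟨τ - 1, last_lt hτ⟩ :=
    hF.lam_first ▸ hF.one_lt_lam_last.ne
  by_cases hβ : ∃ c : ℝ, b = c • β₀
  · obtain ⟨c, rfl⟩ := hβ
    have hc0 : c ≠ 0 := by
      rintro rfl
      exact hb.1 (zero_smul _ _)
    refine ⟨c, ?_, rfl⟩
    by_contra hc
    obtain ⟨s, t, x₀, hst, z, hz, -, -⟩ := hcont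
    obtain ⟨x, hx, hinj⟩ := exists_mem_injective_dotProduct isOpen_interior hz hβ₀
    have hdot : ∀ x : Regressors (τ + 1) K, ∀ t, x t ⬝ᵥ (c • β₀) = c * (x t ⬝ᵥ β₀) :=
      fun x t => dotProduct_smul _ _ _
    exact notMem_outerSet hX hβ₀ hfl isOpen_interior interior_subset
      (fun x _ => detD_smul_same_sign hF hc0 hc (hdot x)) hx
      (detD_smul_first_or_last_ne_zero hF hc0 (hF.ne_one_of_notMem_Ioo hc) (hdot x) hinj) hb
  · push Not at hβ
    obtain ⟨U, hU, hUs, ⟨x, hx⟩, hs⟩ := exists_open_same_strict_sign hF hβ₀ hb.1 hβ hcont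
    refine absurd hb (notMem_outerSet hX hβ₀ hfl hU hUs (fun x hx => (hs x hx).imp
      (fun h j => (h j).le) fun h j => (h j).le) hx ?_)
    exact (hs x hx).elim (fun h => Or.inl (h _).ne') fun h => Or.inl (h _).ne

variable [IsProbabilityMeasure P]

theorem mem_identifiedSet_self (h : IsBinaryChoicePanel P Y X γ ε β₀ F)
    (hF : IsGenLogistic hτ lam w F) : β₀ ∈ identifiedSet P Y X lam := by
  refine ⟨h.β₀_ne_zero, ?_⟩
  filter_upwards [exists_condMoment_eq h hF] with ω ⟨a, _, _, hω⟩
  rw [hω, condMoment_sum_detD]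
  exact Finset.sum_eq_zero fun j _ => by rw [detD_eq_expDet, expDet_row_eq_zero, mul_zero]

theorem exists_smul_of_mem_identifiedSet (h : IsBinaryChoicePanel P Y X γ ε β₀ F)
    (hF : IsGenLogistic hτ lam w F) (hcont : ContinuousRegressors P X)
    (hb : b ∈ identifiedSet P Y X lam) : ∃ c : ℝ, c ≠ 0 ∧ b = c • β₀ := by
  by_cases hβ : ∃ c : ℝ, b = c • β₀
  · obtain ⟨c, rfl⟩ := hβ
    exact ⟨c, fun hc => hb.1 (by rw [hc, zero_smul]), rfl⟩
  · push Not at hβ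
    obtain ⟨U, hU, hUs, ⟨x, hx⟩, hs⟩ :=
      exists_open_same_strict_sign hF h.β₀_ne_zero hb.1 hβ hcont
    obtain ⟨ω, hω, ⟨a, ha, haw, heq⟩, h0⟩ := exists_mem_of_measure_pos
      (measure_preimage_pos h.measurable_X hU hx (hUs hx)) ((exists_condMoment_eq h hF).and hb.2)
    rw [heq, condMoment_sum_detD] at h0
    refine absurd h0 (sum_mul_ne_zero_of_same_sign ha ((hs _ hω).imp
      (fun h j => (h j).le) fun h j => (h j).le) (haw _ hF.w_first) ?_)
    exact (hs _ hω).elim (fun h => (h _).ne') fun h => (h _).ne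

theorem identifiedSet_subset_outerSet (h : IsBinaryChoicePanel P Y X γ ε β₀ F)
    (hF : IsGenLogistic hτ lam w F) (hcont : ContinuousRegressors P X)
    (hw : 0 < w ⟨τ - 1, last_lt hτ⟩) : identifiedSet P Y X lam ⊆ outerSet P X lam β₀ := by
  intro b hb
  refine ⟨hb.1, ?_⟩
  obtain ⟨c, hc, rfl⟩ := exists_smul_of_mem_identifiedSet h hF hcont hb
  have hae : ∀ᵐ ω ∂P, X ω ∉ signSet P X lam β₀ (c • β₀) := by
    filter_upwards [exists_condMoment_eq h hF, hb.2] with ω ⟨a, ha, haw, heq⟩ h0 hω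
    rw [heq, condMoment_sum_detD] at h0
    have hdot : ∀ t, X ω t ⬝ᵥ (c • β₀) = c * (X ω t ⬝ᵥ β₀) := fun t => dotProduct_smul _ _ _
    have : Nonempty (Fin τ) := ⟨⟨0, by omega⟩⟩
    have hbb := (Set.finite_range fun j => detD lam β₀ j (X ω) (c • β₀)).bddBelow
    have hba := (Set.finite_range fun j => detD lam β₀ j (X ω) (c • β₀)).bddAbove
    have hlt := hω.2.elim And.left And.left
    have hsgn : (∀ j, 0 ≤ detD lam β₀ j (X ω) (c • β₀)) ∨
        (∀ j, detD lam β₀ j (X ω) (c • β₀) ≤ 0) :=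
      hω.2.imp (fun h j => h.2.trans (ciInf_le hbb j)) fun h j => (le_ciSup hba j).trans h.2
    have hnz : ¬ ∀ j, detD lam β₀ j (X ω) (c • β₀) = 0 := by
      intro h
      simp [h] at hlt
    -- If `c = 1` or two indices coincide, every `D_j` is zero, against the strict inequality
    -- between maximum and minimum. Otherwise the first or last `D_j` is nonzero, and both weights
    -- are positive.
    by_cases hc1 : c = 1
    · refine hnz fun j => ?_
      rw [hc1, one_smul, detD_eq_expDet, expDet_row_eq_zero]
    by_cases hinj : Function.Injective fun t => X ω t ⬝ᵥ β₀
    · rcases detD_smul_first_or_last_ne_zero hF hc hc1 hdot hinj with hD | hD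
      · exact sum_mul_ne_zero_of_same_sign ha hsgn (haw _ hF.w_first) hD h0
      · exact sum_mul_ne_zero_of_same_sign ha hsgn (haw _ hw) hD h0
    · simp only [Function.Injective, not_forall] at hinj
      obtain ⟨s, t, hst, hne⟩ := hinj
      refine hnz fun j => expDet_eq_zero_of_col_eq lam _ hne ?_ ?_
      · simp only [hst]
      · rw [hdot, hdot, hst]
  simpa [ae_iff] using hae

theorem encard_identifiedSet_le (h : IsBinaryChoicePanel P Y X γ ε β₀ F)
    (hF : IsGenLogistic hτ lam w F) (hcont : ContinuousRegressors P X) :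
    (identifiedSet P Y X lam).encard ≤
      ((if τ = 2 then 2 else (τ + 1).factorial - 1 : ℕ) : ℕ∞) := by
  have hsub : identifiedSet P Y X lam ⊆
      (fun c : ℝ => c • β₀) '' {c | c • β₀ ∈ identifiedSet P Y X lam} := by
    intro b hb
    obtain ⟨c, hc, rfl⟩ := exists_smul_of_mem_identifiedSet h hF hcont hb
    exact ⟨c, hb, rfl⟩
  refine (Set.encard_le_encard hsub).trans ((Set.encard_image_le _ _).trans ?_)
  -- Distinct indices `x_t'β₀` form an open condition met inside the support, hence an event of
  -- positive probability on which zeros in `c` can be counted.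
  have hS : 0 < P (X ⁻¹' {x | Function.Injective fun t => x t ⬝ᵥ β₀}) := by
    obtain ⟨s, t, x₀, hst, z, hz, -, -⟩ := hcont
    obtain ⟨x, hx, hinj⟩ := exists_mem_injective_dotProduct isOpen_interior hz h.β₀_ne_zero
    refine measure_preimage_pos h.measurable_X ?_ hinj (interior_subset hx)
    have : {x : Regressors (τ + 1) K | Function.Injective fun t => x t ⬝ᵥ β₀} =
        ⋂ s, ⋂ t, {x | s = t ∨ x s ⬝ᵥ β₀ ≠ x t ⬝ᵥ β₀} := by
      ext x
      simp only [Set.mem_iInter, Set.mem_ofPred_eq, Function.Injective]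
      refine forall_congr' fun s => forall_congr' fun t => ?_
      tauto
    rw [this]
    refine isOpen_iInter_of_finite fun s => isOpen_iInter_of_finite fun t => ?_
    by_cases hst : s = t
    · simp [hst]
    · simp only [hst, false_or]
      refine isOpen_ne_fun ?_ ?_ <;> (unfold dotProduct; fun_prop)
  refine encard_le_of_ae hS
    (Q := fun c ω => c ≠ 0 ∧ condMoment P Y X lam (c • β₀) (X ω) = 0) (fun c hc => ?_) ?_
  · filter_upwards [hc.2] with ω hω
    exact ⟨fun h0 => hc.1 (by rw [h0, zero_smul]), hω⟩
  · filter_upwards [exists_condMoment_eq h hF] with ω ⟨a, ha, haw, heq⟩ hω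
    refine le_of_eq_of_le ?_ (encard_nonzero_ray_le (f := ⟨0, by omega⟩)
        (l := ⟨τ - 1, last_lt hτ⟩) hτ hF.lam_strictMono (first_le _)
      (le_last _) hF.lam_first hω ha (haw _ hF.w_first))
    congr 1
    ext c
    simp only [Set.mem_ofPred_eq, heq, dotProduct_smul]
    rfl

/-! ### Discrete regressors -/

/-- The trajectories where only the `k`-th regressor is nonzero and takes distinct values. -/
def coordTrajectories (T : ℕ) {K : ℕ} (k : Fin K) : Set (Regressors T K) :=
  {x | (Set.range fun t => x t k).ncard = T ∧ ∀ k', k' ≠ k → ∀ t, x t k' = 0}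

lemma dotProduct_of_mem_coordTrajectories {T : ℕ} {k : Fin K} {x : Regressors T K}
    (hx : x ∈ coordTrajectories T k) (b : Fin K → ℝ) (t : Fin T) : x t ⬝ᵥ b = x t k * b k :=
  Finset.sum_eq_single k (fun k' _ hk' => by rw [hx.2 k' hk' t, zero_mul])
    fun hk => absurd (Finset.mem_univ k) hk

lemma injective_of_mem_coordTrajectories {T : ℕ} {k : Fin K} {x : Regressors T K}
    (hx : x ∈ coordTrajectories T k) : Function.Injective fun t => x t k := by
  have h := hx.1
  rw [← Set.image_univ] at h
  have h2 : ((Set.univ : Set (Fin T))).InjOn fun t => x t k :=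
    Set.injOn_of_ncard_image_eq (by rw [h]; simp [Set.ncard_univ])
  exact Set.injOn_univ.mp h2

/-- If `β₀ k = 0`, the first row of each `D_j` is constant. All `D_j` then equal one Vandermonde
determinant with exponent `0`, which is none of the `b k * lam i` unless `b k = 0`. -/
theorem coord_eq_zero_of_discrete (h : IsBinaryChoicePanel P Y X γ ε β₀ F)
    (hF : IsGenLogistic hτ lam w F) {k : Fin K}
    (hk : 0 < P (X ⁻¹' coordTrajectories (τ + 1) k))
    (hb : b ∈ identifiedSet P Y X lam) (hβk : β₀ k = 0) : b k = 0 := by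
  by_contra hbk
  obtain ⟨ω, hω, ⟨a, ha, haw, heq⟩, h0⟩ := exists_mem_of_measure_pos hk
    ((exists_condMoment_eq h hF).and hb.2)
  have hdot := dotProduct_of_mem_coordTrajectories hω
  rw [heq, condMoment_sum_detD] at h0
  have hne := expDet_exp_ne_zero (lam := lam) (μ := 0) (injective_of_mem_coordTrajectories hω)
    (c := b k) rfl hbk hF.lam_strictMono.injective
    fun i => (mul_ne_zero hbk (zero_lt_one.trans_le (hF.one_le_lam i)).ne').symm
  have hD : ∀ j, detD lam β₀ j (X ω) b =
      expDet lam (b k • fun t => X ω t k) fun t => Real.exp (0 * X ω t k) := fun j => by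
    rw [detD_eq_expDet]
    congr 1
    · ext t
      simp [hdot, mul_comm]
    · ext t
      simp [hdot, hβk]
  simp only [hD] at h0
  exact sum_mul_ne_zero_of_same_sign ha ((le_total 0 _).imp (fun h _ => h) fun h _ => h)
    (haw _ hF.w_first) hne h0

theorem coord_mem_of_discrete (h : IsBinaryChoicePanel P Y X γ ε β₀ F)
    (hF : IsGenLogistic hτ lam w F) (hw : 0 < w ⟨τ - 1, last_lt hτ⟩) {k : Fin K}
    (hk : 0 < P (X ⁻¹' coordTrajectories (τ + 1) k))
    (hb : b ∈ identifiedSet P Y X lam) :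
    ∃ c ∈ ({0} ∪ Set.Ioo (1 / lam ⟨τ - 1, last_lt hτ⟩) (lam ⟨τ - 1, last_lt hτ⟩) : Set ℝ),
      b k = c * β₀ k := by
  by_cases hβk : β₀ k = 0
  · exact ⟨0, Or.inl rfl, by rw [coord_eq_zero_of_discrete h hF hk hb hβk, zero_mul]⟩
  obtain ⟨c, hc⟩ : ∃ c, b k = c * β₀ k := ⟨b k / β₀ k, (div_mul_cancel₀ _ hβk).symm⟩
  refine ⟨c, ?_, hc⟩
  by_contra hcon
  simp only [Set.mem_union, Set.mem_singleton_iff, not_or] at hcon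
  obtain ⟨ω, hω, ⟨a, ha, haw, heq⟩, h0⟩ := exists_mem_of_measure_pos hk
    ((exists_condMoment_eq h hF).and hb.2)
  have hdot := dotProduct_of_mem_coordTrajectories hω
  have hbc : ∀ t, X ω t ⬝ᵥ b = c * (X ω t ⬝ᵥ β₀) := fun t => by
    rw [hdot, hdot, hc]; ring
  have hinj : Function.Injective fun t => X ω t ⬝ᵥ β₀ := fun s t hst => by
    simp only [hdot] at hst
    exact injective_of_mem_coordTrajectories hω (mul_right_cancel₀ hβk hst)
  rw [heq, condMoment_sum_detD] at h0
  have hsgn := detD_smul_same_sign hF hcon.1 hcon.2 hbc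
  rcases detD_smul_first_or_last_ne_zero hF hcon.1 (hF.ne_one_of_notMem_Ioo hcon.2) hbc hinj
    with hD | hD
  · exact sum_mul_ne_zero_of_same_sign ha hsgn (haw _ hF.w_first) hD h0
  · exact sum_mul_ne_zero_of_same_sign ha hsgn (haw _ hw) hD h0

theorem finite_coordSet_of_discrete (h : IsBinaryChoicePanel P Y X γ ε β₀ F)
    (hF : IsGenLogistic hτ lam w F) {k : Fin K}
    (hk : 0 < P (X ⁻¹' coordTrajectories (τ + 1) k)) :
    (coordSet (identifiedSet P Y X lam) k).Finite := by
  by_cases hβk : β₀ k = 0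
  · refine (Set.finite_singleton (0 : ℝ)).subset ?_
    rintro _ ⟨b, hb, rfl⟩
    exact coord_eq_zero_of_discrete h hF hk hb hβk
  set C : Set ℝ := {c | c ≠ 0 ∧ ∃ b ∈ identifiedSet P Y X lam, b k = c * β₀ k} with hC
  have hfin : C.Finite := by
    -- On these trajectories the moment depends on `b` only through `b k`, so each ratio `c = b k /
    -- β₀ k ≠ 0` is a zero of the moment along a scalar ray.
    refine Set.finite_of_encard_le_coe (k := if τ = 2 then 2 else (τ + 1).factorial - 1)
      (encard_le_of_ae hk (Q := fun c ω =>
        c ≠ 0 ∧ ∃ b : Fin K → ℝ, b k = c * β₀ k ∧ condMoment P Y X lam b (X ω) = 0)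
        (fun c hc => ?_) ?_)
    · obtain ⟨hc0, b, hb, hbk⟩ := hc
      filter_upwards [hb.2] with ω hω
      exact ⟨hc0, b, hbk, hω⟩
    · filter_upwards [exists_condMoment_eq h hF] with ω ⟨a, ha, haw, heq⟩ hω
      have hdot := dotProduct_of_mem_coordTrajectories hω
      have hinj : Function.Injective fun t => X ω t ⬝ᵥ β₀ := fun s t hst => by
        simp only [hdot] at hst
        exact injective_of_mem_coordTrajectories hω (mul_right_cancel₀ hβk hst)
      refine (Set.encard_le_encard ?_).trans (encard_nonzero_ray_le (f := ⟨0, by omega⟩)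
        (l := ⟨τ - 1, last_lt hτ⟩) hτ hF.lam_strictMono
        (first_le _) (le_last _) hF.lam_first hinj ha (haw _ hF.w_first))
      rintro c ⟨hc0, b, hbk, h0⟩
      refine ⟨hc0, ?_⟩
      rw [heq] at h0
      rw [← h0]
      congr 1
      ext t
      simp only [Pi.smul_apply, smul_eq_mul, hdot, hbk]
      ring
  refine ((hfin.image fun c => c * β₀ k).insert 0).subset ?_
  rintro _ ⟨b, hb, rfl⟩
  by_cases hb0 : b k = 0
  · exact Or.inl hb0
  · exact Or.inr ⟨b k / β₀ k, ⟨div_ne_zero hb0 hβk, b, hb, (div_mul_cancel₀ _ hβk).symm⟩,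
      div_mul_cancel₀ _ hβk⟩

end

end PanelBinaryChoice

/-! ### Assembly of the discrete and continuous cases -/

theorem mainTheorem2 {Ω : Type*} [MeasurableSpace Ω] (P : Measure Ω) [IsProbabilityMeasure P]
    {τ K : ℕ} (hτ : 2 ≤ τ)
    (Y : Ω → Fin (τ + 1) → Fin 2) (X : Ω → PanelBinaryChoice.Regressors (τ + 1) K)
    (γ : Ω → ℝ) (ε : Ω → Fin (τ + 1) → ℝ) (β₀ : Fin K → ℝ) (F : ℝ → ℝ) (lam w : Fin τ → ℝ)
    (hmodel : PanelBinaryChoice.IsBinaryChoicePanel P Y X γ ε β₀ F)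
    (hF : PanelBinaryChoice.IsGenLogistic hτ lam w F) :
    (PanelBinaryChoice.DiscreteRegressors P X →
      (PanelBinaryChoice.identifiedSet P Y X lam).Finite ∧
      (0 < w ⟨τ - 1, by omega⟩ →
        ∀ k, PanelBinaryChoice.coordSet (PanelBinaryChoice.identifiedSet P Y X lam) k ⊆
          {z | ∃ c ∈ ({0} ∪ Set.Ioo (1 / lam ⟨τ - 1, by omega⟩) (lam ⟨τ - 1, by omega⟩) : Set ℝ),
            z = c * β₀ k})) ∧
    (PanelBinaryChoice.ContinuousRegressors P X →
      (0 < w ⟨τ - 1, by omega⟩ →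
        PanelBinaryChoice.identifiedSet P Y X lam ⊆ PanelBinaryChoice.outerSet P X lam β₀) ∧
      PanelBinaryChoice.outerSet P X lam β₀ ⊆
        {b | ∃ c ∈ Set.Ioo (1 / lam ⟨τ - 1, by omega⟩) (lam ⟨τ - 1, by omega⟩), b = c • β₀} ∧
      (PanelBinaryChoice.identifiedSet P Y X lam).encard ≤
        ((Nat.factorial (τ + 1) - 1 : ℕ) : ℕ∞) ∧
      (τ + 1 = 3 → (PanelBinaryChoice.identifiedSet P Y X lam).encard ≤ 2) ∧
      (∀ k, β₀ k = 0 →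
        PanelBinaryChoice.coordSet (PanelBinaryChoice.identifiedSet P Y X lam) k = {0}) ∧
      (∀ k, β₀ k ≠ 0 →
        0 ∉ PanelBinaryChoice.coordSet (PanelBinaryChoice.identifiedSet P Y X lam) k ∧
        ∀ j, (fun b : Fin K → ℝ => b j / b k) '' PanelBinaryChoice.identifiedSet P Y X lam =
          {β₀ j / β₀ k})) := by
  have hX := hmodel.measurable_X
  have hself := PanelBinaryChoice.mem_identifiedSet_self hmodel hF
  refine ⟨fun hdisc => ?_, fun hcont => ?_⟩
  · have hk : ∀ k, 0 < P (X ⁻¹' PanelBinaryChoice.coordTrajectories (τ + 1) k) := hdisc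
    refine ⟨?_, fun hw k => ?_⟩
    · refine (Set.Finite.pi' fun k =>
        PanelBinaryChoice.finite_coordSet_of_discrete hmodel hF (hk k)).subset ?_
      exact fun b hb k => ⟨b, hb, rfl⟩
    · rintro _ ⟨b, hb, rfl⟩
      exact PanelBinaryChoice.coord_mem_of_discrete hmodel hF hw (hk k) hb
  · have hray := fun b hb => PanelBinaryChoice.exists_smul_of_mem_identifiedSet (b := b)
      hmodel hF hcont hb
    have hcard := PanelBinaryChoice.encard_identifiedSet_le hmodel hF hcont
    refine ⟨PanelBinaryChoice.identifiedSet_subset_outerSet hmodel hF hcont,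
      PanelBinaryChoice.outerSet_subset hX hmodel.β₀_ne_zero hF hcont, hcard.trans ?_,
      fun h3 => ?_, fun k hk => ?_, fun k hk => ⟨?_, fun j => ?_⟩⟩
    · split_ifs with h2
      · subst h2
        exact_mod_cast (show 2 ≤ Nat.factorial 3 - 1 by decide)
      · exact le_rfl
    · rw [if_pos (by omega)] at hcard
      exact hcard
    · refine Set.Subset.antisymm ?_ (Set.singleton_subset_iff.mpr ⟨β₀, hself, hk⟩)
      rintro _ ⟨b, hb, rfl⟩
      obtain ⟨c, -, rfl⟩ := hray b hb
      simp [hk]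
    · rintro ⟨b, hb, hb0⟩
      obtain ⟨c, hc, rfl⟩ := hray b hb
      exact mul_ne_zero hc hk hb0
    · refine Set.Subset.antisymm ?_ (Set.singleton_subset_iff.mpr ⟨β₀, hself, rfl⟩)
      rintro _ ⟨b, hb, rfl⟩
      obtain ⟨c, hc, rfl⟩ := hray b hb
      exact mul_div_mul_left _ _ hc
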